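/- **Conventions.** A *prop* is a strict symmetric monoidal category whose objects are the natural numbers, with tensor product of objects given by addition; a *morphism of props* is a strict symmetric monoidal functor that is the identity on objects. Let $k$ be a field and let $L$ be a set. *Lagrangian affine relations.* Give $(k\oplus k)^n$, with elements $(\phi_i,I_i)_{1\le i\le n}$, the symplectic form $\omega((\phi,I),(\phi',I'))=\sum_i(\phi_iI'_i-\phi'_iI_i)$. For symplectic vector spaces $V,V'$ let $\overline V\oplus V'$ be $V\oplus V'$ with the form $(-\omega_V)\oplus\omega_{V'}$. A *Lagrangian linear relation* $V\nrightarrow V'$ is a Lagrangian (i.e. maximal isotropic) subspace of $\overline V\oplus V'$. A *Lagrangian affine relation* $V\nrightarrow V'$ is a subset of $\overline V\oplus V'$ that is either empty or a translate of a Lagrangian subspace. The Lagrangian linear relations, respectively the Lagrangian affine relations, from $(k\oplus k)^m$ to $(k\oplus k)^n$ are the morphisms $m\to n$ of a prop $\mathrm{LagRel}_k$, respectively $\mathrm{AffLagRel}_k$: composition is that of relations, the tensor product is the direct (cartesian) product of relations, the braiding is $\{(u,v,v,u)\}$. There is an inclusion $\mathrm{LagRel}_k\hookrightarrow\mathrm{AffLagRel}_k$.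 *Circuits.* An *$L$-circuit* from $X$ to $Y$ is a cospan of finite sets $X\to N\leftarrow Y$ together with a finite set $E$ of edges and functions $s,t\colon E\to N$ and $\mathrm{lab}\colon E\to L$. The isomorphism classes of $L$-circuits from $\{1,\dots,m\}$ to $\{1,\dots,n\}$ are the morphisms $m\to n$ of a prop $\mathrm{Circ}_L$: one composes the cospans by pushout and takes the disjoint union of the sets of edges; the tensor product is disjoint union. The circuits with no edges form the prop $\mathrm{FinCospan}$ of isomorphism classes of cospans of finite sets. Each $\ell\in L$ gives a morphism $\ell\colon 1\to1$ of $\mathrm{Circ}_L$: the circuit with two nodes, one of them the input and the other the output, and a single edge, labelled $\ell$, from the input to the output. *Corelations.* $\mathrm{FinCorel}$ is the prop whose morphisms $m\to n$ are the equivalence relations on $\{1,\dots,m\}\sqcup\{1,\dots,n\}$, that is, the isomorphism classes of jointly surjective cospans; one composes and tensors them as cospans and then restricts the apex to the joint image of the legs. The morphism of props $H\colon\mathrm{FinCospan}\to\mathrm{FinCorel}$ restricts the apex of a cospan to the joint image of its legs. The morphism of props $K\colon\mathrm{FinCorel}\to\mathrm{LagRel}_k$ sends a corelation to the relation consisting of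 all families of potentials and currents $(\phi,I)$ at the inputs and outputs such that $\phi$ is constant on each equivalence class and, for each class, the sum of the currents at the inputs in the class equals the sum of the currents at the outputs in it. (So the corelations with one class $m\colon2\to1$, $d\colon1\to2$, $i\colon0\to1$, $e\colon1\to0$ go to $\{\phi_1=\phi_2=\phi_3,\ I_1+I_2=I_3\}$, $\{\phi_1=\phi_2=\phi_3,\ I_1=I_2+I_3\}$, $\{I_2=0\}$, $\{I_1=0\}$.) **Theorem.** For any field $k$, any set $L$, and any choice, for each $\ell\in L$, of a Lagrangian affine relation $\alpha(\ell)$ from $k\oplus k$ to itself, there exists a unique morphism of props $$\blacksquare\colon\mathrm{Circ}_L\to\mathrm{AffLagRel}_k$$ such that the restriction of $\blacksquare$ to $\mathrm{FinCospan}$ is the composite $$\mathrm{FinCospan}\xrightarrow{\ H\ }\mathrm{FinCorel}\xrightarrow{\ K\ }\mathrm{LagRel}_k\hookrightarrow\mathrm{AffLagRel}_k$$ and $\blacksquare(\ell)=\alpha(\ell)$ for every $\ell\in L$. -/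

import Mathlib

universe u v w

namespace Circuits

/-! ### Props -/

/-- The data of a prop: the objects are the natural numbers, the tensor product of objects is
addition; `comp` composes in diagrammatic order. -/
structure PropData where
  Hom : ℕ → ℕ → Type u
  id : ∀ n : ℕ, Hom n n
  comp : ∀ {l m n : ℕ}, Hom l m → Hom m n → Hom l n
  tensor : ∀ {m n m' n' : ℕ}, Hom m n → Hom m' n' → Hom (m + m') (n + n')
  braid : ∀ m n : ℕ, Hom (m + n) (n + m)

/-- Transport of a morphism along equalities of objects. -/
def PropData.castHom (P : PropData.{u}) {m n m' n' : ℕ} (h : m = m') (h' : n = n')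
    (f : P.Hom m n) : P.Hom m' n' :=
  h ▸ h' ▸ f

/-- A prop: a strict symmetric monoidal category whose objects are the natural numbers, with
tensor product of objects given by addition. Strictness means that associators and unitors are
identities, so `tensor` is associative and unital on the nose, up to transport along
`a + b + c = a + (b + c)`, `0 + a = a`, `a + 0 = a`. -/
structure PROP extends PropData.{u} where
  id_comp : ∀ {m n : ℕ} (f : Hom m n), comp (id m) f = f
  comp_id : ∀ {m n : ℕ} (f : Hom m n), comp f (id n) = f
  comp_assoc : ∀ {a b c d : ℕ} (f : Hom a b) (g : Hom b c) (h : Hom c d),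
    comp (comp f g) h = comp f (comp g h)
  tensor_id : ∀ m n : ℕ, tensor (id m) (id n) = id (m + n)
  tensor_comp : ∀ {a b c a' b' c' : ℕ} (f : Hom a b) (g : Hom b c) (f' : Hom a' b')
    (g' : Hom b' c'), tensor (comp f g) (comp f' g') = comp (tensor f f') (tensor g g')
  tensor_assoc : ∀ {a b c a' b' c' : ℕ} (f : Hom a a') (g : Hom b b') (h : Hom c c'),
    toPropData.castHom (add_assoc a b c) (add_assoc a' b' c') (tensor (tensor f g) h) =
      tensor f (tensor g h)
  id_tensor : ∀ {m n : ℕ} (f : Hom m n),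
    toPropData.castHom (zero_add m) (zero_add n) (tensor (id 0) f) = f
  tensor_id_zero : ∀ {m n : ℕ} (f : Hom m n),
    toPropData.castHom (add_zero m) (add_zero n) (tensor f (id 0)) = f
  braid_natural : ∀ {m n m' n' : ℕ} (f : Hom m n) (g : Hom m' n'),
    comp (tensor f g) (braid n n') = comp (braid m m') (tensor g f)
  braid_symm : ∀ m n : ℕ, comp (braid m n) (braid n m) = id (m + n)
  /-- One hexagon identity; the other one follows from it by `braid_symm`. -/
  hexagon : ∀ a b c : ℕ,
    braid a (b + c) =
      comp (toPropData.castHom (add_assoc a b c) (add_assoc b a c)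
          (tensor (braid a b) (id c)))
        (toPropData.castHom rfl (add_assoc b c a).symm (tensor (id b) (braid a c)))

/-- A morphism of props: a strict symmetric monoidal functor that is the identity on objects. -/
@[ext]
structure PROPHom (P : PROP.{u}) (Q : PROP.{v}) where
  map : ∀ {m n : ℕ}, P.Hom m n → Q.Hom m n
  map_id : ∀ n : ℕ, map (P.id n) = Q.id n
  map_comp : ∀ {l m n : ℕ} (f : P.Hom l m) (g : P.Hom m n),
    map (P.comp f g) = Q.comp (map f) (map g)
  map_tensor : ∀ {m n m' n' : ℕ} (f : P.Hom m n) (g : P.Hom m' n'),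
    map (P.tensor f g) = Q.tensor (map f) (map g)
  map_braid : ∀ m n : ℕ, map (P.braid m n) = Q.braid m n

/-- The composite of the morphisms of props `F : P → Q` and `G : Q → R`. -/
def PROPHom.comp {P : PROP.{u}} {Q : PROP.{v}} {R : PROP.{w}}
    (G : PROPHom Q R) (F : PROPHom P Q) : PROPHom P R where
  map f := G.map (F.map f)
  map_id n := by rw [F.map_id, G.map_id]
  map_comp f g := by rw [F.map_comp, G.map_comp]
  map_tensor f g := by rw [F.map_tensor, G.map_tensor]
  map_braid m n := by rw [F.map_braid, G.map_braid]

theorem map_castHom {P : PropData.{u}} {Q : PropData.{v}}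
    (F : ∀ {m n : ℕ}, P.Hom m n → Q.Hom m n) {m n m' n' : ℕ} (h : m = m') (h' : n = n')
    (f : P.Hom m n) : F (P.castHom h h' f) = Q.castHom h h' (F f) := by
  subst h h'; rfl

/-- The laws of a prop pass to an image under maps on morphisms that preserve all operations. -/
def PROP.ofSurjective (P : PROP.{u}) (Q : PropData.{v})
    (F : ∀ {m n : ℕ}, P.Hom m n → Q.Hom m n)
    (hF : ∀ {m n : ℕ}, Function.Surjective (F (m := m) (n := n)))
    (hid : ∀ n : ℕ, F (P.id n) = Q.id n)
    (hcomp : ∀ {l m n : ℕ} (f : P.Hom l m) (g : P.Hom m n),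
      F (P.comp f g) = Q.comp (F f) (F g))
    (htensor : ∀ {m n m' n' : ℕ} (f : P.Hom m n) (g : P.Hom m' n'),
      F (P.tensor f g) = Q.tensor (F f) (F g))
    (hbraid : ∀ m n : ℕ, F (P.braid m n) = Q.braid m n) : PROP.{v} where
  toPropData := Q
  id_comp f := by
    obtain ⟨f, rfl⟩ := hF f
    rw [← hid, ← hcomp, P.id_comp]
  comp_id f := by
    obtain ⟨f, rfl⟩ := hF f
    rw [← hid, ← hcomp, P.comp_id]
  comp_assoc f g h := by
    obtain ⟨f, rfl⟩ := hF f
    obtain ⟨g, rfl⟩ := hF g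
    obtain ⟨h, rfl⟩ := hF h
    simp only [← hcomp, P.comp_assoc]
  tensor_id m n := by simp only [← hid, ← htensor, P.tensor_id]
  tensor_comp f g f' g' := by
    obtain ⟨f, rfl⟩ := hF f
    obtain ⟨g, rfl⟩ := hF g
    obtain ⟨f', rfl⟩ := hF f'
    obtain ⟨g', rfl⟩ := hF g'
    simp only [← hcomp, ← htensor, P.tensor_comp]
  tensor_assoc f g h := by
    obtain ⟨f, rfl⟩ := hF f
    obtain ⟨g, rfl⟩ := hF g
    obtain ⟨h, rfl⟩ := hF h
    simp only [← htensor, ← map_castHom F, P.tensor_assoc]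
  id_tensor f := by
    obtain ⟨f, rfl⟩ := hF f
    simp only [← hid, ← htensor, ← map_castHom F, P.id_tensor]
  tensor_id_zero f := by
    obtain ⟨f, rfl⟩ := hF f
    simp only [← hid, ← htensor, ← map_castHom F, P.tensor_id_zero]
  braid_natural f g := by
    obtain ⟨f, rfl⟩ := hF f
    obtain ⟨g, rfl⟩ := hF g
    simp only [← hbraid, ← htensor, ← hcomp, P.braid_natural]
  braid_symm m n := by simp only [← hbraid, ← hcomp, ← hid, P.braid_symm]
  hexagon a b c := by
    simp only [← hbraid, ← hid, ← htensor, ← map_castHom F, ← hcomp, ← P.hexagon]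

/-- The sub-prop given by a family of morphisms closed under all operations. -/
def PROP.sub (P : PROP.{u}) (p : ∀ {m n : ℕ}, P.Hom m n → Prop)
    (hid : ∀ n : ℕ, p (P.id n))
    (hcomp : ∀ {l m n : ℕ} (f : P.Hom l m) (g : P.Hom m n), p f → p g → p (P.comp f g))
    (htensor : ∀ {m n m' n' : ℕ} (f : P.Hom m n) (g : P.Hom m' n'),
      p f → p g → p (P.tensor f g))
    (hbraid : ∀ m n : ℕ, p (P.braid m n)) : PROP.{u} :=
  let Q : PropData.{u} :=
    { Hom := fun m n => {f : P.Hom m n // p f}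
      id := fun n => ⟨P.id n, hid n⟩
      comp := fun f g => ⟨P.comp f.1 g.1, hcomp _ _ f.2 g.2⟩
      tensor := fun f g => ⟨P.tensor f.1 g.1, htensor _ _ f.2 g.2⟩
      braid := fun m n => ⟨P.braid m n, hbraid m n⟩ }
  have hc : ∀ {m n m' n' : ℕ} (h : m = m') (h' : n = n') (f : Q.Hom m n),
      (Q.castHom h h' f).1 = P.castHom h h' f.1 := fun h h' f =>
    map_castHom (P := Q) (Q := P.toPropData) (fun f => f.1) h h' f
  { Q with
    id_comp := fun _ => Subtype.ext (P.id_comp _)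
    comp_id := fun _ => Subtype.ext (P.comp_id _)
    comp_assoc := fun _ _ _ => Subtype.ext (P.comp_assoc _ _ _)
    tensor_id := fun _ _ => Subtype.ext (P.tensor_id _ _)
    tensor_comp := fun _ _ _ _ => Subtype.ext (P.tensor_comp _ _ _ _)
    tensor_assoc := fun _ _ _ => Subtype.ext ((hc _ _ _).trans (P.tensor_assoc _ _ _))
    id_tensor := fun _ => Subtype.ext ((hc _ _ _).trans (P.id_tensor _))
    tensor_id_zero := fun _ => Subtype.ext ((hc _ _ _).trans (P.tensor_id_zero _))
    braid_natural := fun _ _ => Subtype.ext (P.braid_natural _ _)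
    braid_symm := fun _ _ => Subtype.ext (P.braid_symm _ _)
    hexagon := fun a b c => Subtype.ext ((P.hexagon a b c).trans
      (congrArg₂ P.comp
        (hc (add_assoc a b c) (add_assoc b a c) (Q.tensor (Q.braid a b) (Q.id c))).symm
        (hc rfl (add_assoc b c a).symm (Q.tensor (Q.id b) (Q.braid a c))).symm)) }

/-! ### The prop of relations between powers of a set -/

/-- Relations `X ^ m → X ^ n` with composition of relations, tensored by the cartesian product
`X ^ (m + m') = X ^ m × X ^ m'`. -/
def relData (X : Type u) : PropData.{u} where
  Hom m n := Set ((Fin m → X) × (Fin n → X))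
  id _ := {p | p.1 = p.2}
  comp R S := {p | ∃ v, (p.1, v) ∈ R ∧ (v, p.2) ∈ S}
  tensor {m n m' n'} R S :=
    {p | (fun i => p.1 (Fin.castAdd m' i), fun j => p.2 (Fin.castAdd n' j)) ∈ R ∧
      (fun i => p.1 (Fin.natAdd m i), fun j => p.2 (Fin.natAdd n j)) ∈ S}
  braid m n := {p | (∀ i : Fin m, p.1 (Fin.castAdd n i) = p.2 (Fin.natAdd n i)) ∧
    ∀ j : Fin n, p.1 (Fin.natAdd m j) = p.2 (Fin.castAdd m j)}

theorem relData_castHom {X : Type u} {m n m' n' : ℕ} (h : m = m') (h' : n = n')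
    (R : (relData X).Hom m n) :
    (relData X).castHom h h' R =
      {p : (Fin m' → X) × (Fin n' → X) |
        @Membership.mem _ (Set ((Fin m → X) × (Fin n → X))) _ R
          (fun i => p.1 (Fin.cast h i), fun j => p.2 (Fin.cast h' j))} := by
  subst h h'; rfl

theorem castAdd_castAdd_eq (a b c : ℕ) (i : Fin a) :
    Fin.cast (add_assoc a b c) (Fin.castAdd c (Fin.castAdd b i)) = Fin.castAdd (b + c) i := rfl

theorem castAdd_natAdd_eq (a b c : ℕ) (i : Fin b) :
    Fin.cast (add_assoc a b c) (Fin.castAdd c (Fin.natAdd a i)) =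
      Fin.natAdd a (Fin.castAdd c i) := rfl

theorem natAdd_eq (a b c : ℕ) (i : Fin c) :
    Fin.cast (add_assoc a b c) (Fin.natAdd (a + b) i) =
      Fin.natAdd a (Fin.natAdd b i) := by
  ext; simp [add_assoc]

theorem castAdd_eq' (a b c : ℕ) (i : Fin a) :
    Fin.cast (add_assoc a b c).symm (Fin.castAdd (b + c) i) =
      Fin.castAdd c (Fin.castAdd b i) := rfl

theorem natAdd_castAdd_eq' (a b c : ℕ) (i : Fin b) :
    Fin.cast (add_assoc a b c).symm (Fin.natAdd a (Fin.castAdd c i)) =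
      Fin.castAdd c (Fin.natAdd a i) := rfl

theorem natAdd_natAdd_eq' (a b c : ℕ) (i : Fin c) :
    Fin.cast (add_assoc a b c).symm (Fin.natAdd a (Fin.natAdd b i)) =
      Fin.natAdd (a + b) i := by
  ext; simp [add_assoc]

/-- The prop of sets `X ^ n` and relations. -/
def RelProp (X : Type u) : PROP.{u} where
  toPropData := relData X
  id_comp R := by
    refine Set.ext fun ⟨u, v⟩ => ?_
    exact ⟨fun ⟨_, h, h'⟩ => (show u = _ from h) ▸ h', fun h => ⟨u, rfl, h⟩⟩
  comp_id R := by
    refine Set.ext fun ⟨u, v⟩ => ?_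
    exact ⟨fun ⟨_, h, h'⟩ => (show _ = v from h') ▸ h, fun h => ⟨v, h, rfl⟩⟩
  comp_assoc R S T := by
    refine Set.ext fun ⟨u, v⟩ => ?_
    exact ⟨fun ⟨x, ⟨y, h, h'⟩, h''⟩ => ⟨y, h, x, h', h''⟩,
      fun ⟨y, h, x, h', h''⟩ => ⟨x, ⟨y, h, h'⟩, h''⟩⟩
  tensor_id m n := by
    refine Set.ext fun ⟨u, v⟩ => ?_
    constructor
    · rintro ⟨h, h'⟩
      funext i
      refine Fin.addCases (fun i => ?_) (fun i => ?_) i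
      · exact congrFun h i
      · exact congrFun h' i
    · intro h
      obtain rfl : u = v := h
      exact ⟨rfl, rfl⟩
  tensor_comp {a b c a' b' c'} f g f' g' := by
    refine Set.ext fun ⟨u, v⟩ => ?_
    constructor
    · rintro ⟨⟨x, h, h'⟩, ⟨y, k, k'⟩⟩
      refine ⟨Fin.append x y, ⟨?_, ?_⟩, ⟨?_, ?_⟩⟩ <;> simpa using ‹_›
    · rintro ⟨x, ⟨h, h'⟩, ⟨k, k'⟩⟩
      exact ⟨⟨_, h, k⟩, ⟨_, h', k'⟩⟩
  tensor_assoc {a b c a' b' c'} f g h := by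
    rw [relData_castHom]
    refine Set.ext fun p => ?_
    refine and_assoc.trans (Iff.and Iff.rfl (Iff.and Iff.rfl ?_))
    simp only [natAdd_eq]
  id_tensor f := by
    rw [relData_castHom]
    refine Set.ext fun p => ?_
    refine (and_iff_right ?_).trans ?_
    · exact Subsingleton.elim _ _
    · simp
  tensor_id_zero f := by
    rw [relData_castHom]
    refine Set.ext fun p => ?_
    refine (and_iff_left ?_).trans ?_
    · exact Subsingleton.elim _ _
    · rfl
  braid_natural {m n m' n'} f g := by
    refine Set.ext fun ⟨u, v⟩ => ?_
    constructor
    · rintro ⟨x, ⟨h, h'⟩, k, k'⟩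
      refine ⟨Fin.append (fun i => u (Fin.natAdd _ i)) (fun i => u (Fin.castAdd _ i)),
        ⟨fun i => by simp, fun i => by simp⟩, ?_, ?_⟩
      · rw [show (fun j => x (Fin.natAdd n j)) = fun j => v (Fin.castAdd n j) from
          funext k'] at h'
        simpa using h'
      · rw [show (fun j => x (Fin.castAdd n' j)) = fun j => v (Fin.natAdd n' j) from
          funext k] at h
        simpa using h
    · rintro ⟨x, ⟨h, h'⟩, k, k'⟩
      refine ⟨Fin.append (fun i => v (Fin.natAdd _ i)) (fun i => v (Fin.castAdd _ i)), ⟨?_, ?_⟩,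
        fun i => by simp, fun i => by simp⟩
      · rw [← show (fun j => u (Fin.castAdd m' j)) = fun j => x (Fin.natAdd m' j) from
          funext h] at k'
        simpa using k'
      · rw [← show (fun j => u (Fin.natAdd m j)) = fun j => x (Fin.castAdd m j) from
          funext h'] at k
        simpa using k
  braid_symm m n := by
    refine Set.ext fun ⟨u, v⟩ => ?_
    constructor
    · rintro ⟨x, ⟨h, h'⟩, k, k'⟩
      funext i
      refine Fin.addCases (fun i => ?_) (fun i => ?_) i
      · exact (h i).trans (k' i)
      · exact (h' i).trans (k i)
    · intro h
      obtain rfl : u = v := h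
      exact ⟨Fin.append (fun i => u (Fin.natAdd _ i)) (fun i => u (Fin.castAdd _ i)),
        ⟨fun i => by simp, fun i => by simp⟩, ⟨fun i => by simp, fun i => by simp⟩⟩
  hexagon a b c := by
    rw [relData_castHom, relData_castHom]
    refine Set.ext fun ⟨u, v⟩ => ?_
    constructor
    · rintro ⟨h, h'⟩
      refine ⟨Fin.append (fun i => u (Fin.natAdd _ (Fin.castAdd _ i)))
        (Fin.append (fun i => u (Fin.castAdd _ i))
          (fun i => u (Fin.natAdd _ (Fin.natAdd _ i)))), ⟨⟨?_, ?_⟩, ?_⟩, ⟨?_, ⟨?_, ?_⟩⟩⟩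
      · intro i
        simp [castAdd_castAdd_eq, castAdd_natAdd_eq]
      · intro i
        simp [castAdd_castAdd_eq, castAdd_natAdd_eq]
      · funext i
        simp [natAdd_eq]
      · funext i
        simpa [castAdd_eq'] using h' (Fin.castAdd _ i)
      · intro i
        simpa [natAdd_natAdd_eq'] using h i
      · intro i
        simpa [natAdd_castAdd_eq'] using h' (Fin.natAdd _ i)
    · rintro ⟨x, ⟨⟨h1, h2⟩, h3⟩, ⟨h4, ⟨h5, h6⟩⟩⟩
      constructor
      · intro i
        have e1 := h1 i
        have e2 := h5 i
        simp only [castAdd_castAdd_eq, castAdd_natAdd_eq, natAdd_natAdd_eq'] at e1 e2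
        exact e1.trans e2
      · intro i
        refine Fin.addCases (fun i => ?_) (fun i => ?_) i
        · have e1 := h2 i
          have e2 := congrFun h4 i
          simp only [castAdd_castAdd_eq, castAdd_natAdd_eq, castAdd_eq'] at e1 e2
          exact e1.trans e2
        · have e1 := congrFun h3 i
          have e2 := h6 i
          simp only [natAdd_eq, natAdd_castAdd_eq'] at e1 e2
          exact e1.trans e2

/-! ### Symplectic vector spaces and Lagrangian (affine) relations -/

section Symplectic

variable {k : Type u} [Field k] {V V' V'' : Type v} [AddCommGroup V] [Module k V]
  [AddCommGroup V'] [Module k V'] [AddCommGroup V''] [Module k V'']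

/-- A symplectic structure on a vector space: an alternating nondegenerate bilinear form. -/
structure IsSymplectic (ω : LinearMap.BilinForm k V) : Prop where
  alt : ∀ v, ω v v = 0
  nondeg : ∀ v, (∀ u, ω u v = 0) → v = 0

/-- A subspace on which the form vanishes. -/
def IsIsotropic (ω : LinearMap.BilinForm k V) (W : Submodule k V) : Prop :=
  ∀ v ∈ W, ∀ w ∈ W, ω v w = 0

/-- A Lagrangian subspace: a maximal isotropic subspace. -/
def IsLagrangian (ω : LinearMap.BilinForm k V) (W : Submodule k V) : Prop :=
  Maximal (IsIsotropic ω) W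

/-- The form `(-ω) ⊕ ω'` of the direct sum of the conjugate of `(V, ω)` with `(V', ω')`. -/
def relForm (ω : LinearMap.BilinForm k V) (ω' : LinearMap.BilinForm k V') :
    LinearMap.BilinForm k (V × V') :=
  (-ω).compl₁₂ (LinearMap.fst k V V') (LinearMap.fst k V V') +
    ω'.compl₁₂ (LinearMap.snd k V V') (LinearMap.snd k V V')

@[simp]
theorem relForm_apply (ω : LinearMap.BilinForm k V) (ω' : LinearMap.BilinForm k V')
    (p q : V × V') : relForm ω ω' p q = -ω p.1 q.1 + ω' p.2 q.2 := rfl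

/-- A linear Lagrangian relation from `(V, ω)` to `(V', ω')`: a relation that is a Lagrangian
subspace of the direct sum of the conjugate of `V` with `V'`. -/
def IsLagrangianRel (ω : LinearMap.BilinForm k V) (ω' : LinearMap.BilinForm k V')
    (R : Set (V × V')) : Prop :=
  ∃ W : Submodule k (V × V'), (W : Set (V × V')) = R ∧ IsLagrangian (relForm ω ω') W

/-- A Lagrangian affine relation from `(V, ω)` to `(V', ω')`: a relation that is a (possibly empty)
affine subspace of the direct sum of the conjugate of `V` with `V'`, all of whose tangent spaces
are Lagrangian. The tangent space of an affine subspace at each of its points is its direction. -/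
def IsLagrangianAffineRel (ω : LinearMap.BilinForm k V) (ω' : LinearMap.BilinForm k V')
    (R : Set (V × V')) : Prop :=
  ∃ A : AffineSubspace k (V × V'), (A : Set (V × V')) = R ∧
    ∀ p ∈ A, IsLagrangian (relForm ω ω') A.direction

theorem IsSymplectic.swap {ω : LinearMap.BilinForm k V} (h : IsSymplectic ω) (v w : V) :
    ω v w = -ω w v := by
  have := h.alt (v + w)
  simp only [map_add, LinearMap.add_apply, h.alt, zero_add, add_zero] at this
  exact eq_neg_of_add_eq_zero_right this

theorem IsSymplectic.relForm {ω : LinearMap.BilinForm k V} {ω' : LinearMap.BilinForm k V'}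
    (h : IsSymplectic ω) (h' : IsSymplectic ω') : IsSymplectic (relForm ω ω') where
  alt v := by simp [h.alt, h'.alt]
  nondeg v hv := by
    refine Prod.ext (h.nondeg _ fun u => ?_) (h'.nondeg _ fun u => ?_)
    · simpa using hv (u, 0)
    · simpa using hv (0, u)

theorem IsSymplectic.isLagrangian_iff {ω : LinearMap.BilinForm k V} (h : IsSymplectic ω)
    (W : Submodule k V) : IsLagrangian ω W ↔ ∀ v, v ∈ W ↔ ∀ w ∈ W, ω w v = 0 := by
  constructor
  · intro hW v
    refine ⟨fun hv w hw => hW.1 w hw v hv, fun hv => ?_⟩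
    have hiso : IsIsotropic ω (W ⊔ Submodule.span k {v}) := by
      intro a ha b hb
      obtain ⟨x, hx, y, hy, rfl⟩ := Submodule.mem_sup.1 ha
      obtain ⟨x', hx', y', hy', rfl⟩ := Submodule.mem_sup.1 hb
      obtain ⟨c, rfl⟩ := Submodule.mem_span_singleton.1 hy
      obtain ⟨c', rfl⟩ := Submodule.mem_span_singleton.1 hy'
      simp [hW.1 x hx x' hx', hv x hx, h.alt, h.swap v x', hv x' hx']
    exact hW.2 hiso le_sup_left
      ((le_sup_right : Submodule.span k {v} ≤ _) (Submodule.mem_span_singleton_self v))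
  · intro hW
    refine ⟨fun v hv w hw => (hW w).1 hw v hv, fun W' hW' hle v hv => ?_⟩
    exact (hW v).2 fun w hw => hW' w (hle hw) v hv

/-- A relation is Lagrangian iff it is equal to its symplectic complement. -/
theorem isLagrangianRel_iff {ω : LinearMap.BilinForm k V} {ω' : LinearMap.BilinForm k V'}
    (h : IsSymplectic ω) (h' : IsSymplectic ω') (R : Set (V × V')) :
    IsLagrangianRel ω ω' R ↔ ∀ p, p ∈ R ↔ ∀ q ∈ R, ω q.1 p.1 = ω' q.2 p.2 := by
  have key : ∀ p q : V × V', relForm ω ω' q p = 0 ↔ ω q.1 p.1 = ω' q.2 p.2 := by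
    intro p q
    rw [relForm_apply, neg_add_eq_zero]
  constructor
  · rintro ⟨W, rfl, hW⟩ p
    simpa only [key, SetLike.mem_coe] using ((h.relForm h').isLagrangian_iff W).1 hW p
  · intro hR
    let W : Submodule k (V × V') :=
      { carrier := R
        add_mem' := by
          intro a b ha hb
          rw [hR] at ha hb ⊢
          intro q hq
          simp [ha q hq, hb q hq]
        zero_mem' := by
          rw [hR]
          intro q hq
          simp
        smul_mem' := by
          intro c a ha
          rw [hR] at ha ⊢
          intro q hq
          simp [ha q hq] }
    refine ⟨W, rfl, ((h.relForm h').isLagrangian_iff W).2 fun p => ?_⟩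
    simp only [key]
    exact hR p

theorem IsLagrangianRel.zero_mem {ω : LinearMap.BilinForm k V} {ω' : LinearMap.BilinForm k V'}
    {R : Set (V × V')} (hR : IsLagrangianRel ω ω' R) : (0 : V × V') ∈ R := by
  obtain ⟨W, rfl, -⟩ := hR
  exact W.zero_mem

/-- An inclusion between linear Lagrangian relations is an equality. -/
theorem IsLagrangianRel.eq_of_subset {ω : LinearMap.BilinForm k V}
    {ω' : LinearMap.BilinForm k V'} {R S : Set (V × V')} (hR : IsLagrangianRel ω ω' R)
    (hS : IsLagrangianRel ω ω' S) (h : R ⊆ S) : R = S := by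
  obtain ⟨W, rfl, hW⟩ := hR
  obtain ⟨W', rfl, hW'⟩ := hS
  exact Set.Subset.antisymm h (hW.2 hW'.1 h)

/-- Lagrangian affine relations are empty or translates of linear Lagrangian relations. -/
theorem isLagrangianAffineRel_iff {ω : LinearMap.BilinForm k V} {ω' : LinearMap.BilinForm k V'}
    (R : Set (V × V')) : IsLagrangianAffineRel ω ω' R ↔
      ∀ p ∈ R, ∃ L, IsLagrangianRel ω ω' L ∧ ∀ q, q ∈ R ↔ q - p ∈ L := by
  constructor
  · rintro ⟨A, rfl, hA⟩ p hp
    refine ⟨A.direction, ⟨_, rfl, hA p hp⟩, fun q => ?_⟩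
    exact (AffineSubspace.vsub_right_mem_direction_iff_mem hp q).symm
  · intro hR
    rcases R.eq_empty_or_nonempty with rfl | ⟨p, hp⟩
    · exact ⟨⊥, rfl, fun p hp => hp.elim⟩
    · obtain ⟨L, ⟨W, rfl, hW⟩, hL⟩ := hR p hp
      refine ⟨AffineSubspace.mk' p W, ?_, fun q _ => ?_⟩
      · ext q
        rw [hL q]
        exact AffineSubspace.mem_mk'
      · rwa [AffineSubspace.direction_mk']

theorem IsLagrangianRel.affine {ω : LinearMap.BilinForm k V} {ω' : LinearMap.BilinForm k V'}
    {R : Set (V × V')} (hR : IsLagrangianRel ω ω' R) : IsLagrangianAffineRel ω ω' R := by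
  refine (isLagrangianAffineRel_iff R).2 fun p hp => ⟨R, hR, fun q => ?_⟩
  obtain ⟨W, rfl, -⟩ := hR
  exact (W.sub_mem_iff_left hp).symm

/-- Linear Lagrangian relations are closed under composition. -/
theorem IsLagrangianRel.comp [FiniteDimensional k V] [FiniteDimensional k V']
    [FiniteDimensional k V''] {ω : LinearMap.BilinForm k V} {ω' : LinearMap.BilinForm k V'}
    {ω'' : LinearMap.BilinForm k V''} (h : IsSymplectic ω) (h' : IsSymplectic ω')
    (h'' : IsSymplectic ω'') {R : Set (V × V')} {S : Set (V' × V'')}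
    (hR : IsLagrangianRel ω ω' R) (hS : IsLagrangianRel ω' ω'' S) :
    IsLagrangianRel ω ω'' {p | ∃ v, (p.1, v) ∈ R ∧ (v, p.2) ∈ S} := by
  have hR' := (isLagrangianRel_iff h h' R).1 hR
  have hS' := (isLagrangianRel_iff h' h'' S).1 hS
  refine (isLagrangianRel_iff h h'' _).2 ?_
  rintro ⟨a, c⟩
  constructor
  · rintro ⟨b, hab, hbc⟩ ⟨x, z⟩ ⟨y, hxy, hyz⟩
    exact ((hR' _).1 hab _ hxy).trans ((hS' _).1 hbc _ hyz)
  · intro hac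
    obtain ⟨W, rfl, hW⟩ := hR
    obtain ⟨X, rfl, hX⟩ := hS
    let B : LinearMap.BilinForm k ((V × V') × (V' × V'')) :=
      Circuits.relForm (-Circuits.relForm ω ω') (Circuits.relForm ω' ω'')
    have hBs : IsSymplectic B := by
      refine IsSymplectic.relForm ⟨fun v => ?_, fun v hv => ?_⟩ (h'.relForm h'')
      · simp [h.alt, h'.alt]
      · exact (h.relForm h').nondeg v fun u => neg_eq_zero.1 (hv u)
    have hrefl : B.IsRefl := fun x y hxy => by rw [hBs.swap, hxy, neg_zero]
    have hnd : B.Nondegenerate := by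
      refine ⟨fun x hx => hBs.nondeg x fun y => ?_, fun x hx => hBs.nondeg x hx⟩
      rw [hBs.swap, hx, neg_zero]
    let M : Submodule k ((V × V') × (V' × V'')) := W.prod X
    let D : Submodule k ((V × V') × (V' × V'')) :=
      LinearMap.eqLocus ((LinearMap.snd k V V').comp (LinearMap.fst k _ _))
        ((LinearMap.fst k V' V'').comp (LinearMap.snd k _ _))
    have hM : B.orthogonal M ≤ M := by
      rintro ⟨p, q⟩ hpq
      refine ⟨(hR' p).2 fun r hr => ?_, (hS' q).2 fun r hr => ?_⟩
      · have := hpq (r, 0) ⟨hr, X.zero_mem⟩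
        simpa [B, neg_add_eq_zero, add_neg_eq_zero] using this
      · have := hpq (0, r) ⟨W.zero_mem, hr⟩
        simpa [B, neg_add_eq_zero] using this
    have hD : ∀ p ∈ B.orthogonal D, p.1.1 = 0 ∧ p.2.2 = 0 ∧ p.1.2 = p.2.1 := by
      intro p hp
      refine ⟨h.nondeg _ fun u => ?_, h''.nondeg _ fun u => ?_, ?_⟩
      · have := hp ((u, 0), (0, 0)) rfl
        simpa [B] using this
      · have := hp ((0, 0), (0, u)) rfl
        simpa [B] using this
      · refine sub_eq_zero.1 (h'.nondeg _ fun u => ?_)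
        have := hp ((0, u), (u, 0)) rfl
        simpa [B, ← sub_eq_add_neg] using this
    have hx : (((a, 0), (0, c)) : (V × V') × (V' × V'')) ∈ B.orthogonal (M ⊓ D) := by
      rintro ⟨⟨x, y⟩, ⟨y', z⟩⟩ ⟨⟨hm, hm'⟩, hd⟩
      obtain rfl : y = y' := hd
      have := hac (x, z) ⟨y, hm, hm'⟩
      simp only [] at this
      simp [B, this]
    have hsup : B.orthogonal (M ⊓ D) ≤ M ⊔ B.orthogonal D := by
      rw [← LinearMap.BilinForm.orthogonal_orthogonal hnd hrefl (M ⊔ B.orthogonal D)]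
      refine LinearMap.BilinForm.orthogonal_le (le_inf ?_ ?_)
      · exact (LinearMap.BilinForm.orthogonal_le le_sup_left).trans hM
      · exact (LinearMap.BilinForm.orthogonal_le le_sup_right).trans
          (LinearMap.BilinForm.orthogonal_orthogonal hnd hrefl D).le
    obtain ⟨⟨⟨p1, p2⟩, ⟨p3, p4⟩⟩, ⟨hp, hp'⟩, ⟨⟨q1, q2⟩, ⟨q3, q4⟩⟩, hq, e⟩ :=
      Submodule.mem_sup.1 (hsup hx)
    obtain ⟨h1, h4, h2⟩ := hD _ hq
    simp only [Prod.mk_add_mk, Prod.mk.injEq] at e h1 h4 h2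
    subst h1 h4 h2
    obtain ⟨⟨e1, e2⟩, e3, e4⟩ := e
    rw [add_zero] at e1 e4
    refine ⟨p2, ?_, ?_⟩
    · rw [← e1]
      exact hp
    · rw [← e4, eq_neg_of_add_eq_zero_left e2, ← eq_neg_of_add_eq_zero_left e3]
      exact hp'

end Symplectic

/-! ### The props of linear and affine Lagrangian relations -/

section LagRel

variable (k : Type u) [Field k]

/-- The symplectic structure on `(k ⊕ k) ^ n`, the direct sum of `n` copies of `k ⊕ k` with
`ω ((φ, I), (φ', I')) = φ * I' - φ' * I`. -/
def stdForm (n : ℕ) : LinearMap.BilinForm k (Fin n → k × k) :=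
  LinearMap.mk₂ k (fun u v => ∑ i, ((u i).1 * (v i).2 - (v i).1 * (u i).2))
    (fun a b c => by
      rw [← Finset.sum_add_distrib]
      exact Finset.sum_congr rfl fun i _ => by
        simp only [Pi.add_apply, Prod.fst_add, Prod.snd_add]; ring)
    (fun r a c => by
      rw [Finset.smul_sum]
      exact Finset.sum_congr rfl fun i _ => by
        simp only [Pi.smul_apply, Prod.smul_fst, Prod.smul_snd, smul_eq_mul]; ring)
    (fun a b c => by
      rw [← Finset.sum_add_distrib]
      exact Finset.sum_congr rfl fun i _ => by
        simp only [Pi.add_apply, Prod.fst_add, Prod.snd_add]; ring)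
    (fun r a c => by
      rw [Finset.smul_sum]
      exact Finset.sum_congr rfl fun i _ => by
        simp only [Pi.smul_apply, Prod.smul_fst, Prod.smul_snd, smul_eq_mul]; ring)

theorem stdForm_apply (n : ℕ) (u v : Fin n → k × k) :
    stdForm k n u v = ∑ i, ((u i).1 * (v i).2 - (v i).1 * (u i).2) := rfl

theorem stdForm_symplectic (n : ℕ) : IsSymplectic (stdForm k n) where
  alt v := by simp [stdForm_apply]
  nondeg v hv := by
    funext i
    have h1 := hv (Pi.single i (1, 0))
    have h2 := hv (Pi.single i (0, 1))
    rw [stdForm_apply, Finset.sum_eq_single i (fun j _ hj => by simp [Pi.single_eq_of_ne hj])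
      (by simp)] at h1 h2
    exact Prod.ext (by simpa using h2) (by simpa using h1)

variable {k}

theorem stdForm_add {m n : ℕ} (u v : Fin (m + n) → k × k) :
    stdForm k (m + n) u v =
      stdForm k m (fun i => u (Fin.castAdd n i)) (fun i => v (Fin.castAdd n i)) +
        stdForm k n (fun i => u (Fin.natAdd m i)) (fun i => v (Fin.natAdd m i)) := by
  simp only [stdForm_apply, Fin.sum_univ_add]

/-- The relation `R` from `(k ⊕ k) ^ m` to `(k ⊕ k) ^ n` is a linear Lagrangian relation. -/
abbrev IsLag {m n : ℕ} (R : Set ((Fin m → k × k) × (Fin n → k × k))) : Prop :=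
  IsLagrangianRel (stdForm k m) (stdForm k n) R

/-- The relation `R` from `(k ⊕ k) ^ m` to `(k ⊕ k) ^ n` is a Lagrangian affine relation. -/
abbrev IsAffLag {m n : ℕ} (R : Set ((Fin m → k × k) × (Fin n → k × k))) : Prop :=
  IsLagrangianAffineRel (stdForm k m) (stdForm k n) R

theorem isLag_iff {m n : ℕ} (R : Set ((Fin m → k × k) × (Fin n → k × k))) :
    IsLag R ↔ ∀ p, p ∈ R ↔ ∀ q ∈ R, stdForm k m q.1 p.1 = stdForm k n q.2 p.2 :=
  isLagrangianRel_iff (stdForm_symplectic k m) (stdForm_symplectic k n) R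

theorem isLag_id (n : ℕ) : IsLag ((RelProp (k × k)).id n) := by
  refine (isLag_iff _).2 ?_
  rintro ⟨a, b⟩
  constructor
  · rintro h ⟨c, d⟩ h'
    obtain rfl : a = b := h
    obtain rfl : c = d := h'
    rfl
  · intro h
    refine sub_eq_zero.1 ((stdForm_symplectic k n).nondeg _ fun u => ?_)
    rw [map_sub, sub_eq_zero]
    exact h (u, u) rfl

theorem isLag_comp {l m n : ℕ} (R : (RelProp (k × k)).Hom l m) (S : (RelProp (k × k)).Hom m n)
    (hR : IsLag R) (hS : IsLag S) : IsLag ((RelProp (k × k)).comp R S) :=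
  IsLagrangianRel.comp (stdForm_symplectic k l) (stdForm_symplectic k m)
    (stdForm_symplectic k n) hR hS

theorem append_split {X : Type v} {m n : ℕ} (u : Fin (m + n) → X) :
    Fin.append (fun i => u (Fin.castAdd n i)) (fun i => u (Fin.natAdd m i)) = u := by
  funext i
  refine Fin.addCases (fun i => ?_) (fun i => ?_) i <;> simp

theorem isLag_tensor {m n m' n' : ℕ} (R : Set ((Fin m → k × k) × (Fin n → k × k)))
    (S : Set ((Fin m' → k × k) × (Fin n' → k × k))) (hR : IsLag R) (hS : IsLag S) :
    IsLag ((RelProp (k × k)).tensor (m := m) (n := n) (m' := m') (n' := n') R S) := by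
  refine (isLag_iff _).2 ?_
  rintro ⟨a, b⟩
  have hR' := (isLag_iff _).1 hR
  have hS' := (isLag_iff _).1 hS
  have hz : ∀ (n : ℕ) (v : Fin n → k × k), stdForm k n (fun _ => 0) v = 0 := fun n v => by
    simp [stdForm_apply]
  constructor
  · rintro ⟨h1, h2⟩ ⟨c, d⟩ ⟨h1', h2'⟩
    simp only [stdForm_add]
    exact congrArg₂ _ ((hR' _).1 h1 _ h1') ((hS' _).1 h2 _ h2')
  · intro h
    refine ⟨(hR' _).2 fun q hq => ?_, (hS' _).2 fun q hq => ?_⟩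
    · have hS0 : (fun i => Fin.append q.1 (0 : Fin m' → k × k) (Fin.natAdd m i),
          fun j => Fin.append q.2 (0 : Fin n' → k × k) (Fin.natAdd n j)) ∈ S := by
        simp only [Fin.append_right]
        exact hS.zero_mem
      have := h (Fin.append q.1 (0 : Fin m' → k × k), Fin.append q.2 (0 : Fin n' → k × k))
        ⟨by simpa using hq, hS0⟩
      simpa [stdForm_add, hz] using this
    · have hR0 : (fun i => Fin.append (0 : Fin m → k × k) q.1 (Fin.castAdd m' i),
          fun j => Fin.append (0 : Fin n → k × k) q.2 (Fin.castAdd n' j)) ∈ R := by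
        simp only [Fin.append_left]
        exact hR.zero_mem
      have := h (Fin.append (0 : Fin m → k × k) q.1, Fin.append (0 : Fin n → k × k) q.2)
        ⟨hR0, by simpa using hq⟩
      simpa [stdForm_add, hz] using this

theorem isLag_braid (m n : ℕ) : IsLag ((RelProp (k × k)).braid m n) := by
  have key : ∀ a b c d, (a, b) ∈ (show Set ((Fin (m + n) → k × k) × (Fin (n + m) → k × k)) from
      (RelProp (k × k)).braid m n) → (c, d) ∈
      (show Set ((Fin (m + n) → k × k) × (Fin (n + m) → k × k)) from
        (RelProp (k × k)).braid m n) →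
      stdForm k (m + n) c a = stdForm k (n + m) d b := by
    rintro a b c d ⟨h1, h2⟩ ⟨h1', h2'⟩
    rw [stdForm_add, stdForm_add, add_comm, funext h1, funext h2, funext h1', funext h2']
  refine (isLag_iff _).2 ?_
  rintro ⟨a, b⟩
  constructor
  · rintro h ⟨c, d⟩ h'
    exact key a b c d h h'
  · intro h
    have hu : ∀ {m n : ℕ} (u : Fin (m + n) → k × k), ∃ v : Fin (n + m) → k × k,
        (∀ i : Fin m, u (Fin.castAdd n i) = v (Fin.natAdd n i)) ∧
          ∀ j : Fin n, u (Fin.natAdd m j) = v (Fin.castAdd m j) := fun u =>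
      ⟨Fin.append (fun i => u (Fin.natAdd _ i)) (fun i => u (Fin.castAdd _ i)),
        fun i => by simp, fun i => by simp⟩
    obtain ⟨a', h1, h2⟩ := hu b
    have ha' : (a', b) ∈ (show Set ((Fin (m + n) → k × k) × (Fin (n + m) → k × k)) from
      (RelProp (k × k)).braid m n) := ⟨fun i => (h2 i).symm, fun i => (h1 i).symm⟩
    suffices a = a' by rwa [this]
    refine sub_eq_zero.1 ((stdForm_symplectic k _).nondeg _ fun u => ?_)
    rw [map_sub, sub_eq_zero]
    obtain ⟨v, hv⟩ := hu u
    exact (h (u, v) hv).trans (key a' b u v ha' hv).symm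

/-- The prop whose morphisms `m → n` are the linear Lagrangian relations from `(k ⊕ k) ^ m` to
`(k ⊕ k) ^ n`, with composition of relations and direct sum. -/
def LagRel (k : Type u) [Field k] : PROP.{u} :=
  (RelProp (k × k)).sub (fun R => IsLag R) isLag_id isLag_comp isLag_tensor isLag_braid

theorem isAffLag_comp {l m n : ℕ} (R : (RelProp (k × k)).Hom l m)
    (S : (RelProp (k × k)).Hom m n) (hR : IsAffLag R) (hS : IsAffLag S) :
    IsAffLag ((RelProp (k × k)).comp R S) := by
  refine (isLagrangianAffineRel_iff _).2 ?_
  rintro ⟨a, c⟩ ⟨b, hab, hbc⟩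
  obtain ⟨L, hL, hRL⟩ := (isLagrangianAffineRel_iff _).1 hR _ hab
  obtain ⟨M, hM, hSM⟩ := (isLagrangianAffineRel_iff _).1 hS _ hbc
  refine ⟨_, isLag_comp L M hL hM, ?_⟩
  rintro ⟨x, z⟩
  constructor
  · rintro ⟨y, hxy, hyz⟩
    exact ⟨y - b, (hRL _).1 hxy, (hSM _).1 hyz⟩
  · rintro ⟨y, hxy, hyz⟩
    refine ⟨y + b, (hRL _).2 ?_, (hSM _).2 ?_⟩
    · simpa using hxy
    · simpa using hyz

theorem isAffLag_tensor {m n m' n' : ℕ} (R : (RelProp (k × k)).Hom m n)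
    (S : (RelProp (k × k)).Hom m' n') (hR : IsAffLag R) (hS : IsAffLag S) :
    IsAffLag ((RelProp (k × k)).tensor R S) := by
  refine (isLagrangianAffineRel_iff _).2 ?_
  rintro ⟨a, c⟩ ⟨h, h'⟩
  obtain ⟨L, hL, hRL⟩ := (isLagrangianAffineRel_iff _).1 hR _ h
  obtain ⟨M, hM, hSM⟩ := (isLagrangianAffineRel_iff _).1 hS _ h'
  exact ⟨_, isLag_tensor L M hL hM, fun q => and_congr (hRL _) (hSM _)⟩

/-- The prop whose morphisms `m → n` are the Lagrangian affine relations from `(k ⊕ k) ^ m` to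
`(k ⊕ k) ^ n`, with composition of relations and direct sum. -/
def AffLagRel (k : Type u) [Field k] : PROP.{u} :=
  (RelProp (k × k)).sub (fun R => IsAffLag R) (fun n => (isLag_id n).affine) isAffLag_comp
    isAffLag_tensor (fun m n => (isLag_braid m n).affine)

/-- The inclusion of linear Lagrangian relations into Lagrangian affine relations. -/
def LagRel.toAffLagRel (k : Type u) [Field k] : PROPHom (LagRel k) (AffLagRel k) where
  map R := ⟨R.1, R.2.affine⟩
  map_id _ := rfl
  map_comp _ _ := rfl
  map_tensor _ _ := rfl
  map_braid _ _ := rfl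

end LagRel

/-! ### Cospans and circuits -/

/-- The generating relation of the pushout of `f : Y → A` and `g : Y → B`. -/
inductive PushoutRel {A B Y : Type} (f : Y → A) (g : Y → B) : A ⊕ B → A ⊕ B → Prop
  | glue (y : Y) : PushoutRel f g (Sum.inl (f y)) (Sum.inr (g y))

/-- The pushout of the functions `f : Y → A` and `g : Y → B`: the disjoint union of `A` and `B`
with `f y` and `g y` identified for all `y`. -/
def Pushout {A B Y : Type} (f : Y → A) (g : Y → B) : Type :=
  Quot (PushoutRel f g)

namespace Pushout

variable {A B Y : Type} {f : Y → A} {g : Y → B}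

def inl (f : Y → A) (g : Y → B) (a : A) : Pushout f g := Quot.mk _ (Sum.inl a)

def inr (f : Y → A) (g : Y → B) (b : B) : Pushout f g := Quot.mk _ (Sum.inr b)

theorem glue (f : Y → A) (g : Y → B) (y : Y) : inl f g (f y) = inr f g (g y) :=
  Quot.sound (PushoutRel.glue y)

/-- The function out of the pushout given by the universal property. -/
def desc {C : Type v} (p : A → C) (q : B → C) (h : ∀ y, p (f y) = q (g y)) :
    Pushout f g → C :=
  Quot.lift (Sum.elim p q) (by rintro _ _ ⟨y⟩; exact h y)

@[simp]
theorem desc_inl {C : Type v} (p : A → C) (q : B → C) (h : ∀ y, p (f y) = q (g y)) (a : A) :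
    desc p q h (inl f g a) = p a := rfl

@[simp]
theorem desc_inr {C : Type v} (p : A → C) (q : B → C) (h : ∀ y, p (f y) = q (g y)) (b : B) :
    desc p q h (inr f g b) = q b := rfl

theorem ind {p : Pushout f g → Prop} (hl : ∀ a, p (inl f g a)) (hr : ∀ b, p (inr f g b)) :
    ∀ x, p x := by
  rintro ⟨a | b⟩
  · exact hl a
  · exact hr b

instance [Finite A] [Finite B] : Finite (Pushout f g) := Quot.finite _

end Pushout

/-- A cospan of sets `X → N ← Y` with finite apex `N`. -/
structure Cospan (X Y : Type) : Type 1 where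
  N : Type
  [finN : Finite N]
  inp : X → N
  out : Y → N

/-- An `L`-circuit from `X` to `Y`: a cospan `X → N ← Y` together with a finite graph with set of
nodes `N` and set of edges `E`, whose edges are labelled by elements of `L`. -/
structure Circuit (L : Type u) (X Y : Type) : Type (max 1 u) extends Cospan X Y where
  E : Type
  [finE : Finite E]
  src : E → N
  tgt : E → N
  lab : E → L

attribute [instance] Cospan.finN Circuit.finE

namespace Cospan

variable {X Y Z : Type}

/-- Two cospans are isomorphic if there is a bijection between their apices that commutes with the
legs. -/
def Iso (c d : Cospan X Y) : Prop :=
  ∃ f : c.N ≃ d.N, (∀ x, f (c.inp x) = d.inp x) ∧ ∀ y, f (c.out y) = d.out y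

/-- The cospan `X → X ← Y` given by the identity and a function `g : Y → X`. -/
def ofFun [Finite X] (g : Y → X) : Cospan X Y where
  N := X
  inp := id
  out := g

/-- Composition of cospans by pushout. -/
def comp (c : Cospan X Y) (d : Cospan Y Z) : Cospan X Z where
  N := Pushout c.out d.inp
  inp x := Pushout.inl _ _ (c.inp x)
  out z := Pushout.inr _ _ (d.out z)

/-- The disjoint union of cospans; the set `Fin (m + m')` is identified with the disjoint union of
`Fin m` and `Fin m'`. -/
def tensor {m n m' n' : ℕ} (c : Cospan (Fin m) (Fin n)) (d : Cospan (Fin m') (Fin n')) :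
    Cospan (Fin (m + m')) (Fin (n + n')) where
  N := c.N ⊕ d.N
  inp := Fin.addCases (fun i => Sum.inl (c.inp i)) (fun i => Sum.inr (d.inp i))
  out := Fin.addCases (fun i => Sum.inl (c.out i)) (fun i => Sum.inr (d.out i))

/-- A cospan, seen as a circuit with no edges. -/
def toCircuit (L : Type u) (c : Cospan X Y) : Circuit L X Y where
  toCospan := c
  E := Empty
  src := Empty.elim
  tgt := Empty.elim
  lab := Empty.elim

end Cospan

instance {X Y : Type} (L : Type u) (c : Cospan X Y) : IsEmpty (c.toCircuit L).E :=
  inferInstanceAs (IsEmpty Empty)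

namespace Circuit

variable {L : Type u} {X Y Z W : Type}

/-- Two circuits are isomorphic if there are bijections between their sets of nodes and between
their sets of edges that preserve all the structure. -/
def Iso (c d : Circuit L X Y) : Prop :=
  ∃ (f : c.N ≃ d.N) (g : c.E ≃ d.E), (∀ x, f (c.inp x) = d.inp x) ∧
    (∀ y, f (c.out y) = d.out y) ∧ (∀ e, f (c.src e) = d.src (g e)) ∧
    (∀ e, f (c.tgt e) = d.tgt (g e)) ∧ ∀ e, c.lab e = d.lab (g e)

theorem Iso.refl (c : Circuit L X Y) : Iso c c :=
  ⟨Equiv.refl _, Equiv.refl _, fun _ => rfl, fun _ => rfl, fun _ => rfl, fun _ => rfl,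
    fun _ => rfl⟩

theorem Iso.symm {c d : Circuit L X Y} : Iso c d → Iso d c := by
  rintro ⟨f, g, h1, h2, h3, h4, h5⟩
  refine ⟨f.symm, g.symm, fun x => ?_, fun x => ?_, fun x => ?_, fun x => ?_, fun x => ?_⟩
  · rw [← h1, f.symm_apply_apply]
  · rw [← h2, f.symm_apply_apply]
  · rw [Equiv.symm_apply_eq, h3, g.apply_symm_apply]
  · rw [Equiv.symm_apply_eq, h4, g.apply_symm_apply]
  · rw [h5, g.apply_symm_apply]

theorem Iso.trans {c d e : Circuit L X Y} : Iso c d → Iso d e → Iso c e := by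
  rintro ⟨f, g, h1, h2, h3, h4, h5⟩ ⟨f', g', h1', h2', h3', h4', h5'⟩
  exact ⟨f.trans f', g.trans g', fun x => by simp [h1, h1'], fun x => by simp [h2, h2'],
    fun x => by simp [h3, h3'], fun x => by simp [h4, h4'], fun x => by rw [h5, h5']; rfl⟩

instance setoid (L : Type u) (X Y : Type) : Setoid (Circuit L X Y) where
  r := Iso
  iseqv := ⟨Iso.refl, Iso.symm, Iso.trans⟩

/-- Composition of circuits: the cospans are composed by pushout, the set of edges is the disjoint
union. -/
def comp (c : Circuit L X Y) (d : Circuit L Y Z) : Circuit L X Z where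
  toCospan := c.toCospan.comp d.toCospan
  E := c.E ⊕ d.E
  src := Sum.elim (fun e => Pushout.inl _ _ (c.src e)) (fun e => Pushout.inr _ _ (d.src e))
  tgt := Sum.elim (fun e => Pushout.inl _ _ (c.tgt e)) (fun e => Pushout.inr _ _ (d.tgt e))
  lab := Sum.elim c.lab d.lab

/-- The disjoint union of circuits. -/
def tensor {m n m' n' : ℕ} (c : Circuit L (Fin m) (Fin n)) (d : Circuit L (Fin m') (Fin n')) :
    Circuit L (Fin (m + m')) (Fin (n + n')) where
  toCospan := c.toCospan.tensor d.toCospan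
  E := c.E ⊕ d.E
  src := Sum.map c.src d.src
  tgt := Sum.map c.tgt d.tgt
  lab := Sum.elim c.lab d.lab

/-- The circuit with a single edge, labelled by `ℓ`, from the only input to the only output. -/
def edge (ℓ : L) : Circuit L (Fin 1) (Fin 1) where
  N := Bool
  inp _ := false
  out _ := true
  E := Unit
  src _ := false
  tgt _ := true
  lab _ := ℓ

/-- Precomposition of the legs of a circuit with functions. -/
def reindex {X' Y' : Type} (c : Circuit L X Y) (σ : X' → X) (τ : Y' → Y) : Circuit L X' Y' :=
  { c with
    inp := fun x => c.inp (σ x)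
    out := fun y => c.out (τ y) }

theorem comp_congr {c c' : Circuit L X Y} {d d' : Circuit L Y Z} :
    Iso c c' → Iso d d' → Iso (c.comp d) (c'.comp d') := by
  rintro ⟨f, g, h1, h2, h3, h4, h5⟩ ⟨f', g', h1', h2', h3', h4', h5'⟩
  refine ⟨⟨Pushout.desc (fun a => Pushout.inl _ _ (f a)) (fun b => Pushout.inr _ _ (f' b))
      fun y => ?_,
    Pushout.desc (fun a => Pushout.inl _ _ (f.symm a)) (fun b => Pushout.inr _ _ (f'.symm b))
      fun y => ?_, ?_, ?_⟩, Equiv.sumCongr g g', fun x => ?_, fun x => ?_, ?_, ?_, ?_⟩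
  · rw [h2, h1', Pushout.glue]
  · rw [← h2, ← h1', Equiv.symm_apply_apply, Equiv.symm_apply_apply, Pushout.glue]
  · exact Pushout.ind (fun a => congrArg (Pushout.inl _ _) (f.symm_apply_apply a))
      fun b => congrArg (Pushout.inr _ _) (f'.symm_apply_apply b)
  · exact Pushout.ind (fun a => congrArg (Pushout.inl _ _) (f.apply_symm_apply a))
      fun b => congrArg (Pushout.inr _ _) (f'.apply_symm_apply b)
  · exact congrArg (Pushout.inl c'.out d'.inp) (h1 x)
  · exact congrArg (Pushout.inr c'.out d'.inp) (h2' x)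
  · rintro (e | e)
    · exact congrArg (Pushout.inl c'.out d'.inp) (h3 e)
    · exact congrArg (Pushout.inr c'.out d'.inp) (h3' e)
  · rintro (e | e)
    · exact congrArg (Pushout.inl c'.out d'.inp) (h4 e)
    · exact congrArg (Pushout.inr c'.out d'.inp) (h4' e)
  · rintro (e | e)
    · exact h5 e
    · exact h5' e

theorem tensor_inp_left {m n m' n' : ℕ} (c : Circuit L (Fin m) (Fin n))
    (d : Circuit L (Fin m') (Fin n')) (i : Fin m) :
    (c.tensor d).inp (Fin.castAdd m' i) = Sum.inl (c.inp i) := by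
  simp [tensor, Cospan.tensor]

theorem tensor_inp_right {m n m' n' : ℕ} (c : Circuit L (Fin m) (Fin n))
    (d : Circuit L (Fin m') (Fin n')) (i : Fin m') :
    (c.tensor d).inp (Fin.natAdd m i) = Sum.inr (d.inp i) := by
  simp [tensor, Cospan.tensor]

theorem tensor_out_left {m n m' n' : ℕ} (c : Circuit L (Fin m) (Fin n))
    (d : Circuit L (Fin m') (Fin n')) (i : Fin n) :
    (c.tensor d).out (Fin.castAdd n' i) = Sum.inl (c.out i) := by
  simp [tensor, Cospan.tensor]

theorem tensor_out_right {m n m' n' : ℕ} (c : Circuit L (Fin m) (Fin n))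
    (d : Circuit L (Fin m') (Fin n')) (i : Fin n') :
    (c.tensor d).out (Fin.natAdd n i) = Sum.inr (d.out i) := by
  simp [tensor, Cospan.tensor]

theorem tensor_congr {m n m' n' : ℕ} {c c' : Circuit L (Fin m) (Fin n)}
    {d d' : Circuit L (Fin m') (Fin n')} :
    Iso c c' → Iso d d' → Iso (c.tensor d) (c'.tensor d') := by
  rintro ⟨f, g, h1, h2, h3, h4, h5⟩ ⟨f', g', h1', h2', h3', h4', h5'⟩
  refine ⟨Equiv.sumCongr f f', Equiv.sumCongr g g', fun x => ?_, fun x => ?_, ?_, ?_, ?_⟩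
  · refine Fin.addCases (fun i => ?_) (fun i => ?_) x
    · rw [tensor_inp_left, tensor_inp_left, ← h1]
      rfl
    · rw [tensor_inp_right, tensor_inp_right, ← h1']
      rfl
  · refine Fin.addCases (fun i => ?_) (fun i => ?_) x
    · rw [tensor_out_left, tensor_out_left, ← h2]
      rfl
    · rw [tensor_out_right, tensor_out_right, ← h2']
      rfl
  · rintro (e | e)
    · exact congrArg _ (h3 e)
    · exact congrArg _ (h3' e)
  · rintro (e | e)
    · exact congrArg _ (h4 e)
    · exact congrArg _ (h4' e)
  · rintro (e | e)
    · exact h5 e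
    · exact h5' e

theorem comp_assoc (c : Circuit L X Y) (d : Circuit L Y Z) (e : Circuit L Z W) :
    Iso ((c.comp d).comp e) (c.comp (d.comp e)) := by
  refine ⟨⟨Pushout.desc (Pushout.desc (fun a => Pushout.inl _ _ a)
        (fun b => Pushout.inr _ _ (Pushout.inl _ _ b)) fun y => ?_)
      (fun x => Pushout.inr _ _ (Pushout.inr _ _ x)) fun y => ?_,
    Pushout.desc (fun a => Pushout.inl _ _ (Pushout.inl _ _ a))
      (Pushout.desc (fun b => Pushout.inl _ _ (Pushout.inr _ _ b))
        (fun x => Pushout.inr _ _ x) fun y => ?_) fun y => ?_, ?_, ?_⟩,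
    Equiv.sumAssoc _ _ _, fun x => rfl, fun x => rfl, ?_, ?_, ?_⟩
  · exact Pushout.glue c.out (d.comp e).inp y
  · exact congrArg (Pushout.inr c.out (d.comp e).inp) (Pushout.glue d.out e.inp y)
  · exact Pushout.glue (c.comp d).out e.inp y
  · exact congrArg (Pushout.inl (c.comp d).out e.inp) (Pushout.glue c.out d.inp y)
  · exact Pushout.ind (Pushout.ind (fun _ => rfl) fun _ => rfl) fun _ => rfl
  · exact Pushout.ind (fun _ => rfl) (Pushout.ind (fun _ => rfl) fun _ => rfl)
  · rintro ((e | e) | e) <;> rfl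
  · rintro ((e | e) | e) <;> rfl
  · rintro ((e | e) | e) <;> rfl

theorem tensor_comp {a b c a' b' c' : ℕ} (f : Circuit L (Fin a) (Fin b))
    (g : Circuit L (Fin b) (Fin c)) (f' : Circuit L (Fin a') (Fin b'))
    (g' : Circuit L (Fin b') (Fin c')) :
    Iso ((f.comp g).tensor (f'.comp g')) ((f.tensor f').comp (g.tensor g')) := by
  have hg : ∀ y : Fin b, (Pushout.inl (f.tensor f').out (g.tensor g').inp (Sum.inl (f.out y))) =
      Pushout.inr _ _ (Sum.inl (g.inp y)) := fun y => by
    have := Pushout.glue (f.tensor f').out (g.tensor g').inp (Fin.castAdd b' y)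
    rwa [tensor_out_left, tensor_inp_left] at this
  have hg' : ∀ y : Fin b', (Pushout.inl (f.tensor f').out (g.tensor g').inp
      (Sum.inr (f'.out y))) = Pushout.inr _ _ (Sum.inr (g'.inp y)) := fun y => by
    have := Pushout.glue (f.tensor f').out (g.tensor g').inp (Fin.natAdd b y)
    rwa [tensor_out_right, tensor_inp_right] at this
  refine ⟨⟨Sum.elim (Pushout.desc (fun x => Pushout.inl _ _ (Sum.inl x))
        (fun x => Pushout.inr _ _ (Sum.inl x)) hg)
      (Pushout.desc (fun x => Pushout.inl _ _ (Sum.inr x))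
        (fun x => Pushout.inr _ _ (Sum.inr x)) hg'),
    Pushout.desc (Sum.map (Pushout.inl _ _) (Pushout.inl _ _))
      (Sum.map (Pushout.inr _ _) (Pushout.inr _ _)) ?_, ?_, ?_⟩,
    Equiv.sumSumSumComm _ _ _ _, fun x => ?_, fun x => ?_, ?_, ?_, ?_⟩
  · intro y
    refine Fin.addCases (fun i => ?_) (fun i => ?_) y
    · rw [tensor_out_left, tensor_inp_left]
      exact congrArg Sum.inl (Pushout.glue f.out g.inp i)
    · rw [tensor_out_right, tensor_inp_right]
      exact congrArg Sum.inr (Pushout.glue f'.out g'.inp i)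
  · rintro (x | x)
    · revert x
      exact Pushout.ind (fun _ => rfl) fun _ => rfl
    · revert x
      exact Pushout.ind (fun _ => rfl) fun _ => rfl
  · refine Pushout.ind ?_ ?_ <;> rintro (x | x) <;> rfl
  · refine Fin.addCases (fun i => ?_) (fun i => ?_) x
    · rw [tensor_inp_left]
      exact congrArg (Pushout.inl _ _) (tensor_inp_left f f' i).symm
    · rw [tensor_inp_right]
      exact congrArg (Pushout.inl _ _) (tensor_inp_right f f' i).symm
  · refine Fin.addCases (fun i => ?_) (fun i => ?_) x
    · rw [tensor_out_left]
      exact congrArg (Pushout.inr _ _) (tensor_out_left g g' i).symm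
    · rw [tensor_out_right]
      exact congrArg (Pushout.inr _ _) (tensor_out_right g g' i).symm
  · rintro ((e | e) | (e | e)) <;> rfl
  · rintro ((e | e) | (e | e)) <;> rfl
  · rintro ((e | e) | (e | e)) <;> rfl

/-- The circuit with no edges given by the identity of `X` and a function `g : Y → X`. -/
abbrev ofFun (L : Type u) [Finite X] (g : Y → X) : Circuit L X Y :=
  (Cospan.ofFun g).toCircuit L

theorem comp_ofFun [Finite Y] (c : Circuit L X Y) (g : Z → Y) :
    Iso (c.comp (ofFun L g)) (c.reindex id g) := by
  refine ⟨⟨Pushout.desc id c.out fun y => rfl, Pushout.inl _ _, ?_, fun x => rfl⟩,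
    Equiv.sumEmpty _ _, fun x => rfl, fun x => rfl, ?_, ?_, ?_⟩
  · refine Pushout.ind (fun _ => rfl) fun y => ?_
    exact Pushout.glue c.out (ofFun L g).inp y
  · rintro (e | e)
    · rfl
    · exact e.elim
  · rintro (e | e)
    · rfl
    · exact e.elim
  · rintro (e | e)
    · rfl
    · exact e.elim

theorem ofFun_comp [Finite X] (g : Y ≃ X) (c : Circuit L Y Z) :
    Iso ((ofFun L g).comp c) (c.reindex g.symm id) := by
  refine ⟨⟨Pushout.desc (fun x => c.inp (g.symm x)) id fun y => ?_, Pushout.inr _ _, ?_,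
      fun x => rfl⟩,
    Equiv.emptySum _ _, fun x => rfl, fun x => rfl, ?_, ?_, ?_⟩
  · exact congrArg c.inp (g.symm_apply_apply y)
  · refine Pushout.ind (fun x => ?_) fun _ => rfl
    have := Pushout.glue (ofFun L g).out c.inp (g.symm x)
    refine this.symm.trans (congrArg _ (g.apply_symm_apply x))
  · rintro (e | e)
    · exact e.elim
    · rfl
  · rintro (e | e)
    · exact e.elim
    · rfl
  · rintro (e | e)
    · exact e.elim
    · rfl

theorem reindex_ofFun [Finite X] {X' Y' : Type} [Finite X'] (g : Y → X) (σ : X' ≃ X)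
    (τ : Y' → Y) : Iso ((ofFun L g).reindex σ τ) (ofFun L fun y => σ.symm (g (τ y))) :=
  ⟨σ.symm, Equiv.refl _, fun x => σ.symm_apply_apply x, fun _ => rfl, fun e => e.elim,
    fun e => e.elim, fun e => e.elim⟩

theorem ofFun_tensor {m n m' n' : ℕ} (g : Fin n → Fin m) (h : Fin n' → Fin m') :
    Iso ((ofFun L g).tensor (ofFun L h))
      (ofFun L (Fin.addCases (fun i => Fin.castAdd m' (g i)) fun i => Fin.natAdd m (h i))) := by
  refine ⟨finSumFinEquiv, Equiv.sumEmpty _ _, fun x => ?_, fun x => ?_, fun e => ?_, fun e => ?_,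
    fun e => ?_⟩
  · refine Fin.addCases (fun i => ?_) (fun i => ?_) x
    · rw [tensor_inp_left]
      rfl
    · rw [tensor_inp_right]
      rfl
  · refine Fin.addCases (fun i => ?_) (fun i => ?_) x
    · rw [tensor_out_left]
      change _ = Fin.addCases (motive := fun _ => Fin (m + m')) (fun i => Fin.castAdd m' (g i))
        (fun i => Fin.natAdd m (h i)) (Fin.castAdd n' i)
      rw [Fin.addCases_left]
      rfl
    · rw [tensor_out_right]
      change _ = Fin.addCases (motive := fun _ => Fin (m + m')) (fun i => Fin.castAdd m' (g i))
        (fun i => Fin.natAdd m (h i)) (Fin.natAdd n i)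
      rw [Fin.addCases_right]
      rfl
  · rcases e with e | e <;> exact e.elim
  · rcases e with e | e <;> exact e.elim
  · rcases e with e | e <;> exact e.elim

theorem tensor_assoc {a b c a' b' c' : ℕ} (f : Circuit L (Fin a) (Fin a'))
    (g : Circuit L (Fin b) (Fin b')) (h : Circuit L (Fin c) (Fin c')) :
    Iso (((f.tensor g).tensor h).reindex (finCongr (add_assoc a b c).symm)
      (finCongr (add_assoc a' b' c').symm)) (f.tensor (g.tensor h)) := by
  refine ⟨Equiv.sumAssoc _ _ _, Equiv.sumAssoc _ _ _, fun x => ?_, fun x => ?_, ?_, ?_, ?_⟩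
  · refine Fin.addCases (fun i => ?_) (fun i => Fin.addCases (fun i => ?_) (fun i => ?_) i) x
    · rw [tensor_inp_left]
      change Equiv.sumAssoc _ _ _ (((f.tensor g).tensor h).inp
        (Fin.cast (add_assoc a b c).symm (Fin.castAdd (b + c) i))) = _
      rw [castAdd_eq', tensor_inp_left, tensor_inp_left]
      rfl
    · rw [tensor_inp_right, tensor_inp_left]
      change Equiv.sumAssoc _ _ _ (((f.tensor g).tensor h).inp
        (Fin.cast (add_assoc a b c).symm (Fin.natAdd a (Fin.castAdd c i)))) = _
      rw [natAdd_castAdd_eq', tensor_inp_left, tensor_inp_right]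
      rfl
    · rw [tensor_inp_right, tensor_inp_right]
      change Equiv.sumAssoc _ _ _ (((f.tensor g).tensor h).inp
        (Fin.cast (add_assoc a b c).symm (Fin.natAdd a (Fin.natAdd b i)))) = _
      rw [natAdd_natAdd_eq', tensor_inp_right]
      rfl
  · refine Fin.addCases (fun i => ?_) (fun i => Fin.addCases (fun i => ?_) (fun i => ?_) i) x
    · rw [tensor_out_left]
      change Equiv.sumAssoc _ _ _ (((f.tensor g).tensor h).out
        (Fin.cast (add_assoc a' b' c').symm (Fin.castAdd (b' + c') i))) = _
      rw [castAdd_eq', tensor_out_left, tensor_out_left]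
      rfl
    · rw [tensor_out_right, tensor_out_left]
      change Equiv.sumAssoc _ _ _ (((f.tensor g).tensor h).out
        (Fin.cast (add_assoc a' b' c').symm (Fin.natAdd a' (Fin.castAdd c' i)))) = _
      rw [natAdd_castAdd_eq', tensor_out_left, tensor_out_right]
      rfl
    · rw [tensor_out_right, tensor_out_right]
      change Equiv.sumAssoc _ _ _ (((f.tensor g).tensor h).out
        (Fin.cast (add_assoc a' b' c').symm (Fin.natAdd a' (Fin.natAdd b' i)))) = _
      rw [natAdd_natAdd_eq', tensor_out_right]
      rfl
  · rintro ((e | e) | e) <;> rfl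
  · rintro ((e | e) | e) <;> rfl
  · rintro ((e | e) | e) <;> rfl

theorem id_tensor {m n : ℕ} (c : Circuit L (Fin m) (Fin n)) :
    Iso (((ofFun L (id : Fin 0 → Fin 0)).tensor c).reindex (finCongr (zero_add m).symm)
      (finCongr (zero_add n).symm)) c := by
  refine ⟨Equiv.emptySum (Fin 0) _, Equiv.emptySum Empty _, fun x => ?_, fun x => ?_, ?_, ?_, ?_⟩
  · change Equiv.emptySum (Fin 0) _ (((ofFun L (id : Fin 0 → Fin 0)).tensor c).inp
      (Fin.cast (zero_add m).symm x)) = _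
    rw [← Fin.natAdd_zero, tensor_inp_right]
    rfl
  · change Equiv.emptySum (Fin 0) _ (((ofFun L (id : Fin 0 → Fin 0)).tensor c).out
      (Fin.cast (zero_add n).symm x)) = _
    rw [← Fin.natAdd_zero, tensor_out_right]
    rfl
  · rintro (e | e)
    · exact e.elim
    · rfl
  · rintro (e | e)
    · exact e.elim
    · rfl
  · rintro (e | e)
    · exact e.elim
    · rfl

theorem tensor_id_zero {m n : ℕ} (c : Circuit L (Fin m) (Fin n)) :
    Iso ((c.tensor (ofFun L (id : Fin 0 → Fin 0))).reindex (finCongr (add_zero m).symm)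
      (finCongr (add_zero n).symm)) c := by
  refine ⟨Equiv.sumEmpty _ (Fin 0), Equiv.sumEmpty _ Empty, fun x => ?_, fun x => ?_, ?_, ?_, ?_⟩
  · exact congrArg (Equiv.sumEmpty _ (Fin 0)) (tensor_inp_left c (ofFun L id) x)
  · exact congrArg (Equiv.sumEmpty _ (Fin 0)) (tensor_out_left c (ofFun L id) x)
  · rintro (e | e)
    · rfl
    · exact e.elim
  · rintro (e | e)
    · rfl
    · exact e.elim
  · rintro (e | e)
    · rfl
    · exact e.elim

theorem tensor_comm {m n m' n' : ℕ} (f : Circuit L (Fin m) (Fin n))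
    (g : Circuit L (Fin m') (Fin n')) :
    Iso ((f.tensor g).reindex id (finAddFlip : Fin (n' + n) ≃ Fin (n + n')))
      ((g.tensor f).reindex (finAddFlip : Fin (m' + m) ≃ Fin (m + m')).symm id) := by
  refine ⟨Equiv.sumComm _ _, Equiv.sumComm _ _, fun x => ?_, fun x => ?_, ?_, ?_, ?_⟩
  · refine Fin.addCases (fun i => ?_) (fun i => ?_) x
    · change Equiv.sumComm _ _ ((f.tensor g).inp (Fin.castAdd m' i)) = (g.tensor f).inp
        (finAddFlip (Fin.castAdd m' i))
      rw [finAddFlip_apply_castAdd, tensor_inp_left, tensor_inp_right]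
      rfl
    · change Equiv.sumComm _ _ ((f.tensor g).inp (Fin.natAdd m i)) = (g.tensor f).inp
        (finAddFlip (Fin.natAdd m i))
      rw [finAddFlip_apply_natAdd, tensor_inp_right, tensor_inp_left]
      rfl
  · refine Fin.addCases (fun i => ?_) (fun i => ?_) x
    · change Equiv.sumComm _ _ ((f.tensor g).out (finAddFlip (Fin.castAdd n i))) =
        (g.tensor f).out (Fin.castAdd n i)
      rw [finAddFlip_apply_castAdd, tensor_out_right, tensor_out_left]
      rfl
    · change Equiv.sumComm _ _ ((f.tensor g).out (finAddFlip (Fin.natAdd n' i))) =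
        (g.tensor f).out (Fin.natAdd n' i)
      rw [finAddFlip_apply_natAdd, tensor_out_left, tensor_out_right]
      rfl
  · rintro (e | e) <;> rfl
  · rintro (e | e) <;> rfl
  · rintro (e | e) <;> rfl

end Circuit

/-- Isomorphism classes of `L`-circuits. -/
def circData (L : Type u) : PropData.{max 1 u} where
  Hom m n := Quotient (Circuit.setoid L (Fin m) (Fin n))
  id n := Quotient.mk _ (Circuit.ofFun L (id : Fin n → Fin n))
  comp := Quotient.map₂ Circuit.comp fun _ _ h _ _ h' => Circuit.comp_congr h h'
  tensor := Quotient.map₂ Circuit.tensor fun _ _ h _ _ h' => Circuit.tensor_congr h h'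
  braid m n := Quotient.mk _ (Circuit.ofFun L (finAddFlip : Fin (n + m) ≃ Fin (m + n)))

theorem circData_castHom {L : Type u} {m n m' n' : ℕ} (h : m = m') (h' : n = n')
    (c : Circuit L (Fin m) (Fin n)) :
    (circData L).castHom h h' (Quotient.mk _ c) =
      Quotient.mk _ (c.reindex (finCongr h.symm) (finCongr h'.symm)) := by
  subst h h'; rfl

/-- The prop of isomorphism classes of `L`-circuits. -/
def Circ (L : Type u) : PROP.{max 1 u} where
  toPropData := circData L
  id_comp := by
    rintro m n ⟨c⟩
    exact Quotient.sound (Circuit.ofFun_comp (Equiv.refl _) c)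
  comp_id := by
    rintro m n ⟨c⟩
    exact Quotient.sound (Circuit.comp_ofFun c id)
  comp_assoc := by
    rintro _ _ _ _ ⟨c⟩ ⟨d⟩ ⟨e⟩
    exact Quotient.sound (Circuit.comp_assoc c d e)
  tensor_id m n := by
    refine (Quotient.sound (Circuit.ofFun_tensor id id)).trans ?_
    congr 2
    funext i
    refine Fin.addCases (fun i => ?_) (fun i => ?_) i <;> simp
  tensor_comp := by
    rintro _ _ _ _ _ _ ⟨f⟩ ⟨g⟩ ⟨f'⟩ ⟨g'⟩
    exact Quotient.sound (Circuit.tensor_comp f g f' g')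
  tensor_assoc := by
    rintro a b c a' b' c' ⟨f⟩ ⟨g⟩ ⟨h⟩
    refine (circData_castHom _ _ _).trans (Quotient.sound (Circuit.tensor_assoc f g h))
  id_tensor := by
    rintro m n ⟨c⟩
    refine (circData_castHom _ _ _).trans (Quotient.sound (Circuit.id_tensor c))
  tensor_id_zero := by
    rintro m n ⟨c⟩
    refine (circData_castHom _ _ _).trans (Quotient.sound (Circuit.tensor_id_zero c))
  braid_natural := by
    rintro m n m' n' ⟨f⟩ ⟨g⟩
    exact (Quotient.sound (Circuit.comp_ofFun _ _)).trans
      (Eq.trans (Quotient.sound (Circuit.tensor_comm f g))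
        (Quotient.sound (Circuit.ofFun_comp _ _)).symm)
  braid_symm m n := by
    refine (Quotient.sound (Circuit.comp_ofFun _ _)).trans
      ((Quotient.sound (Circuit.reindex_ofFun _ (Equiv.refl _) _)).trans ?_)
    refine congrArg (fun g => Quotient.mk _ (Circuit.ofFun L g)) (funext fun i => ?_)
    exact finAddFlip.apply_symm_apply i
  hexagon a b c := by
    have h1 := (congrArg ((circData L).castHom (add_assoc a b c) (add_assoc b a c))
      (Quotient.sound (Circuit.ofFun_tensor (L := L) (finAddFlip : Fin (b + a) ≃ Fin (a + b))
        (id : Fin c → Fin c)))).trans ((circData_castHom _ _ _).trans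
          (Quotient.sound (Circuit.reindex_ofFun _ (finCongr (add_assoc a b c).symm) _)))
    have h2 := (congrArg ((circData L).castHom rfl (add_assoc b c a).symm)
      (Quotient.sound (Circuit.ofFun_tensor (L := L) (id : Fin b → Fin b)
        (finAddFlip : Fin (c + a) ≃ Fin (a + c))))).trans ((circData_castHom _ _ _).trans
          (Quotient.sound (Circuit.reindex_ofFun _ (finCongr rfl) _)))
    refine Eq.trans ?_ (congrArg₂ (circData L).comp h1 h2).symm
    refine Eq.trans ?_ ((Quotient.sound (Circuit.comp_ofFun _ _)).trans
      (Quotient.sound (Circuit.reindex_ofFun _ (Equiv.refl _) _))).symm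
    refine congrArg (fun g => Quotient.mk _ (Circuit.ofFun L g)) (funext fun i => ?_)
    refine Fin.addCases (fun i => Fin.addCases (fun i => ?_) (fun i => ?_) i) (fun i => ?_) i
    · simp [natAdd_castAdd_eq', castAdd_castAdd_eq, natAdd_eq]
    · simp [castAdd_eq', castAdd_castAdd_eq, castAdd_natAdd_eq]
    · simp [natAdd_natAdd_eq', castAdd_natAdd_eq, natAdd_eq]

/-- The generating morphism `ℓ : 1 → 1` of `Circ L`: the circuit with a single edge labelled `ℓ`. -/
def Circ.edge {L : Type u} (ℓ : L) : (Circ L).Hom 1 1 :=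
  Quotient.mk _ (Circuit.edge ℓ)

namespace Cospan

variable {X Y Z : Type}

theorem Iso.toCircuit {c d : Cospan X Y} (h : Iso c d) (L : Type u) :
    Circuit.Iso (c.toCircuit L) (d.toCircuit L) := by
  obtain ⟨f, h1, h2⟩ := h
  exact ⟨f, Equiv.refl _, h1, h2, fun e => e.elim, fun e => e.elim, fun e => e.elim⟩

theorem Iso.ofCircuit {L : Type u} {c d : Circuit L X Y} (h : Circuit.Iso c d) :
    Iso c.toCospan d.toCospan := by
  obtain ⟨f, -, h1, h2, -⟩ := h
  exact ⟨f, h1, h2⟩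

instance setoid (X Y : Type) : Setoid (Cospan X Y) where
  r := Iso
  iseqv :=
    ⟨fun c => Iso.ofCircuit (Circuit.Iso.refl (c.toCircuit Empty)),
      fun h => Iso.ofCircuit (h.toCircuit Empty).symm,
      fun h h' => Iso.ofCircuit ((h.toCircuit Empty).trans (h'.toCircuit Empty))⟩

theorem comp_congr {c c' : Cospan X Y} {d d' : Cospan Y Z} (h : Iso c c') (h' : Iso d d') :
    Iso (c.comp d) (c'.comp d') :=
  Iso.ofCircuit (Circuit.comp_congr (h.toCircuit Empty) (h'.toCircuit Empty))

theorem tensor_congr {m n m' n' : ℕ} {c c' : Cospan (Fin m) (Fin n)}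
    {d d' : Cospan (Fin m') (Fin n')} (h : Iso c c') (h' : Iso d d') :
    Iso (c.tensor d) (c'.tensor d') :=
  Iso.ofCircuit (Circuit.tensor_congr (h.toCircuit Empty) (h'.toCircuit Empty))

end Cospan

/-- Isomorphism classes of cospans of finite sets. -/
def finCospanData : PropData.{1} where
  Hom m n := Quotient (Cospan.setoid (Fin m) (Fin n))
  id n := Quotient.mk _ (Cospan.ofFun (id : Fin n → Fin n))
  comp := Quotient.map₂ Cospan.comp fun _ _ h _ _ h' => Cospan.comp_congr h h'
  tensor := Quotient.map₂ Cospan.tensor fun _ _ h _ _ h' => Cospan.tensor_congr h h'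
  braid m n := Quotient.mk _ (Cospan.ofFun (finAddFlip : Fin (n + m) ≃ Fin (m + n)))

/-- The prop of isomorphism classes of cospans of finite sets. Its laws follow from those of
`Circ`, since it is obtained by forgetting the edges of circuits. -/
def FinCospan : PROP.{1} :=
  PROP.ofSurjective (Circ Empty) finCospanData
    (fun {_ _} => Quotient.map Circuit.toCospan fun _ _ h => Cospan.Iso.ofCircuit h)
    (fun {_ _} => by
      rintro ⟨c⟩
      exact ⟨Quotient.mk _ (c.toCircuit Empty), rfl⟩)
    (fun _ => rfl)
    (by
      rintro _ _ _ ⟨c⟩ ⟨d⟩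
      rfl)
    (by
      rintro _ _ _ _ ⟨c⟩ ⟨d⟩
      rfl)
    (fun _ _ => rfl)

/-- The inclusion of cospans of finite sets into circuits, as the circuits with no edges. -/
def FinCospan.toCirc (L : Type u) : PROPHom FinCospan (Circ L) where
  map {_ _} := Quotient.map (Cospan.toCircuit L) fun _ _ h => Cospan.Iso.toCircuit h L
  map_id _ := rfl
  map_comp := by
    rintro _ _ _ ⟨c⟩ ⟨d⟩
    exact Quotient.sound ⟨Equiv.refl _, (Equiv.sumEmpty Empty Empty).symm, fun _ => rfl,
      fun _ => rfl, fun e => e.elim, fun e => e.elim, fun e => e.elim⟩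
  map_tensor := by
    rintro _ _ _ _ ⟨c⟩ ⟨d⟩
    exact Quotient.sound ⟨Equiv.refl _, (Equiv.sumEmpty Empty Empty).symm, fun _ => rfl,
      fun _ => rfl, fun e => e.elim, fun e => e.elim, fun e => e.elim⟩
  map_braid _ _ := rfl

/-! ### Corelations -/

theorem exists_option_of_ker {A B C : Type} {f : A → B} {f' : A → C}
    (h : Setoid.ker f ≤ Setoid.ker f') : ∃ g : B → Option C, ∀ a, g (f a) = some (f' a) :=
  ⟨Function.extend f (fun a => some (f' a)) fun _ => none,
    (show Function.FactorsThrough (fun a => some (f' a)) f from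
      fun _ _ hab => congrArg some (h hab)).extend_apply _⟩

theorem ker_le_of_option {A B C : Type} {f : A → B} {f' : A → C} (g : B → Option C)
    (h : ∀ a, g (f a) = some (f' a)) : Setoid.ker f ≤ Setoid.ker f' := by
  intro a b hab
  have : g (f a) = g (f b) := congrArg g hab
  rw [h, h] at this
  exact Option.some.inj this

namespace Cospan

variable {X Y Z : Type}

/-- The two legs of a cospan `X → N ← Y`, as a function `X ⊕ Y → N`. -/
def legs (c : Cospan X Y) : X ⊕ Y → c.N := Sum.elim c.inp c.out

/-- The corelation of a cospan: the equivalence relation on `X ⊕ Y` that relates the elements with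
the same image in the apex. It describes the cospan with the apex restricted to the joint image of
the two legs. -/
def ker (c : Cospan X Y) : Setoid (X ⊕ Y) := Setoid.ker c.legs

/-- The jointly surjective cospan `X → (X ⊕ Y) / r ← Y` of a corelation `r`. -/
def ofSetoid [Finite X] [Finite Y] (r : Setoid (X ⊕ Y)) : Cospan X Y where
  N := Quotient r
  inp x := Quotient.mk r (Sum.inl x)
  out y := Quotient.mk r (Sum.inr y)

theorem legs_ofSetoid [Finite X] [Finite Y] (r : Setoid (X ⊕ Y)) (a : X ⊕ Y) :
    (ofSetoid r).legs a = Quotient.mk r a := by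
  cases a <;> rfl

theorem ker_ofSetoid [Finite X] [Finite Y] (r : Setoid (X ⊕ Y)) : (ofSetoid r).ker = r := by
  refine Setoid.ext fun a b => ?_
  change (ofSetoid r).legs a = (ofSetoid r).legs b ↔ _
  rw [legs_ofSetoid, legs_ofSetoid]
  exact Quotient.eq

theorem Iso.ker_eq {c d : Cospan X Y} (h : Iso c d) : c.ker = d.ker := by
  obtain ⟨f, h1, h2⟩ := h
  have : ∀ a, f (c.legs a) = d.legs a := by
    rintro (x | y)
    · exact h1 x
    · exact h2 y
  refine Setoid.ext fun a b => ?_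
  change c.legs a = c.legs b ↔ d.legs a = d.legs b
  rw [← this, ← this, f.apply_eq_iff_eq]

theorem ker_comp_le {c c' : Cospan X Y} {d d' : Cospan Y Z} (h : c.ker ≤ c'.ker)
    (h' : d.ker ≤ d'.ker) : (c.comp d).ker ≤ (c'.comp d').ker := by
  obtain ⟨g, hg⟩ := exists_option_of_ker h
  obtain ⟨g', hg'⟩ := exists_option_of_ker h'
  refine ker_le_of_option (Pushout.desc
    (fun a => (g a).map (Pushout.inl c'.out d'.inp))
    (fun b => (g' b).map (Pushout.inr c'.out d'.inp)) fun y => ?_) ?_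
  · have h1 : g (c.out y) = some (c'.out y) := hg (Sum.inr y)
    have h2 : g' (d.inp y) = some (d'.inp y) := hg' (Sum.inl y)
    rw [h1, h2]
    exact congrArg some (Pushout.glue c'.out d'.inp y)
  · rintro (x | z)
    · exact congrArg (Option.map (Pushout.inl c'.out d'.inp)) (hg (Sum.inl x))
    · exact congrArg (Option.map (Pushout.inr c'.out d'.inp)) (hg' (Sum.inr z))

theorem ker_comp_congr {c c' : Cospan X Y} {d d' : Cospan Y Z} (h : c.ker = c'.ker)
    (h' : d.ker = d'.ker) : (c.comp d).ker = (c'.comp d').ker :=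
  le_antisymm (ker_comp_le h.le h'.le) (ker_comp_le h.ge h'.ge)

/-- The decomposition of `Fin (m + m') ⊕ Fin (n + n')` into `Fin m ⊕ Fin n` and
`Fin m' ⊕ Fin n'`. -/
theorem forall_split {m n m' n' : ℕ} {p : Fin (m + m') ⊕ Fin (n + n') → Prop}
    (h : ∀ a : Fin m ⊕ Fin n, p (Sum.map (Fin.castAdd m') (Fin.castAdd n') a))
    (h' : ∀ a : Fin m' ⊕ Fin n', p (Sum.map (Fin.natAdd m) (Fin.natAdd n) a)) : ∀ a, p a := by
  rintro (x | y)
  · exact Fin.addCases (fun i => h (Sum.inl i)) (fun i => h' (Sum.inl i)) x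
  · exact Fin.addCases (fun i => h (Sum.inr i)) (fun i => h' (Sum.inr i)) y

theorem legs_tensor_left {m n m' n' : ℕ} (c : Cospan (Fin m) (Fin n))
    (d : Cospan (Fin m') (Fin n')) (a : Fin m ⊕ Fin n) :
    (c.tensor d).legs (Sum.map (Fin.castAdd m') (Fin.castAdd n') a) = Sum.inl (c.legs a) := by
  cases a <;> simp [legs, tensor]

theorem legs_tensor_right {m n m' n' : ℕ} (c : Cospan (Fin m) (Fin n))
    (d : Cospan (Fin m') (Fin n')) (a : Fin m' ⊕ Fin n') :
    (c.tensor d).legs (Sum.map (Fin.natAdd m) (Fin.natAdd n) a) = Sum.inr (d.legs a) := by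
  cases a <;> simp [legs, tensor]

theorem ker_tensor_le {m n m' n' : ℕ} {c c' : Cospan (Fin m) (Fin n)}
    {d d' : Cospan (Fin m') (Fin n')} (h : c.ker ≤ c'.ker) (h' : d.ker ≤ d'.ker) :
    (c.tensor d).ker ≤ (c'.tensor d').ker := by
  obtain ⟨g, hg⟩ := exists_option_of_ker h
  obtain ⟨g', hg'⟩ := exists_option_of_ker h'
  refine ker_le_of_option
    (Sum.elim (fun a => (g a).map Sum.inl) (fun b => (g' b).map Sum.inr))
    (forall_split (fun a => ?_) fun a => ?_)
  · rw [legs_tensor_left, legs_tensor_left]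
    exact congrArg (Option.map Sum.inl) (hg a)
  · rw [legs_tensor_right, legs_tensor_right]
    exact congrArg (Option.map Sum.inr) (hg' a)

theorem ker_tensor_congr {m n m' n' : ℕ} {c c' : Cospan (Fin m) (Fin n)}
    {d d' : Cospan (Fin m') (Fin n')} (h : c.ker = c'.ker) (h' : d.ker = d'.ker) :
    (c.tensor d).ker = (c'.tensor d').ker :=
  le_antisymm (ker_tensor_le h.le h'.le) (ker_tensor_le h.ge h'.ge)

end Cospan

/-- Corelations of finite sets. A corelation from `Fin m` to `Fin n` is an equivalence relation on
`Fin m ⊕ Fin n`, or equivalently an isomorphism class of jointly surjective cospans. Corelations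
are composed by composing the cospans and restricting the result to its joint image. -/
def finCorelData : PropData.{0} where
  Hom m n := Setoid (Fin m ⊕ Fin n)
  id n := (Cospan.ofFun (id : Fin n → Fin n)).ker
  comp r s := ((Cospan.ofSetoid r).comp (Cospan.ofSetoid s)).ker
  tensor r s := ((Cospan.ofSetoid r).tensor (Cospan.ofSetoid s)).ker
  braid m n := (Cospan.ofFun (finAddFlip : Fin (n + m) ≃ Fin (m + n))).ker

/-- The corelation of an isomorphism class of cospans. -/
def toCorel {m n : ℕ} : FinCospan.Hom m n → finCorelData.Hom m n :=
  Quotient.lift Cospan.ker fun _ _ h => Cospan.Iso.ker_eq h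

theorem toCorel_comp {l m n : ℕ} (f : FinCospan.Hom l m) (g : FinCospan.Hom m n) :
    toCorel (FinCospan.comp f g) = finCorelData.comp (toCorel f) (toCorel g) := by
  obtain ⟨c⟩ := f
  obtain ⟨d⟩ := g
  exact Cospan.ker_comp_congr (Cospan.ker_ofSetoid _).symm (Cospan.ker_ofSetoid _).symm

theorem toCorel_tensor {m n m' n' : ℕ} (f : FinCospan.Hom m n) (g : FinCospan.Hom m' n') :
    toCorel (FinCospan.tensor f g) = finCorelData.tensor (toCorel f) (toCorel g) := by
  obtain ⟨c⟩ := f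
  obtain ⟨d⟩ := g
  exact Cospan.ker_tensor_congr (Cospan.ker_ofSetoid _).symm (Cospan.ker_ofSetoid _).symm

/-- The prop of corelations of finite sets. -/
def FinCorel : PROP.{0} :=
  PROP.ofSurjective FinCospan finCorelData toCorel
    (fun {_ _} r => ⟨Quotient.mk _ (Cospan.ofSetoid r), Cospan.ker_ofSetoid r⟩)
    (fun _ => rfl) toCorel_comp toCorel_tensor (fun _ _ => rfl)

/-- The morphism of props that sends a cospan to the corelation obtained by restricting its apex
to the joint image of its legs. -/
def H : PROPHom FinCospan FinCorel where
  map := toCorel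
  map_id _ := rfl
  map_comp := toCorel_comp
  map_tensor := toCorel_tensor
  map_braid _ _ := rfl

/-! ### The black-boxing of corelations -/

section K

variable {k : Type u} [Field k] {m n : ℕ}

/-- The potential at an input or output. -/
def pot (p : (Fin m → k × k) × (Fin n → k × k)) : Fin m ⊕ Fin n → k :=
  Sum.elim (fun x => (p.1 x).1) (fun y => (p.2 y).1)

open Classical in
/-- The behaviour of a corelation, seen as a collection of ideal wires, one for each class: all
the potentials on a wire are equal, and the sum of the currents flowing in at the inputs on the wire
equals the sum of the currents flowing out at the outputs on it. -/
def kRel (k : Type u) [Field k] {m n : ℕ} (r : Setoid (Fin m ⊕ Fin n)) :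
    Set ((Fin m → k × k) × (Fin n → k × k)) :=
  {p | (∀ a b, r a b → pot p a = pot p b) ∧
    ∀ a, ∑ x with r (Sum.inl x) a, (p.1 x).2 = ∑ y with r (Sum.inr y) a, (p.2 y).2}

theorem sum_classes {r : Setoid (Fin m ⊕ Fin n)} {p : (Fin m → k × k) × (Fin n → k × k)}
    (hp : p ∈ kRel k r) (q : Fin m ⊕ Fin n → k) (hq : ∀ a b, r a b → q a = q b) :
    ∑ x, q (Sum.inl x) * (p.1 x).2 = ∑ y, q (Sum.inr y) * (p.2 y).2 := by
  classical
  have : Fintype (Quotient r) := Fintype.ofFinite _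
  rw [← Finset.sum_fiberwise Finset.univ (fun x => Quotient.mk r (Sum.inl x)),
    ← Finset.sum_fiberwise Finset.univ (fun y => Quotient.mk r (Sum.inr y))]
  refine Finset.sum_congr rfl fun c _ => ?_
  obtain ⟨a, rfl⟩ := Quotient.exists_rep c
  have h := congrArg (q a * ·) (hp.2 a)
  simp only [Finset.mul_sum] at h
  simp only [Quotient.eq]
  convert h using 1
  · refine Finset.sum_congr (by ext; simp) fun x hx => ?_
    rw [hq _ a (Finset.mem_filter.1 hx).2]
  · refine Finset.sum_congr (by ext; simp) fun x hx => ?_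
    rw [hq _ a (Finset.mem_filter.1 hx).2]

theorem mem_kRel_iff {r : Setoid (Fin m ⊕ Fin n)} {p : (Fin m → k × k) × (Fin n → k × k)} :
    p ∈ kRel k r ↔ (∀ a b, r a b → pot p a = pot p b) ∧
      ∀ q : Fin m ⊕ Fin n → k, (∀ a b, r a b → q a = q b) →
        ∑ x, q (Sum.inl x) * (p.1 x).2 = ∑ y, q (Sum.inr y) * (p.2 y).2 := by
  classical
  refine ⟨fun hp => ⟨hp.1, sum_classes hp⟩, fun ⟨h, h'⟩ => ⟨h, fun a => ?_⟩⟩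
  have := h' (fun b => if r b a then 1 else 0) fun b c hbc => by
    have : r b a ↔ r c a := ⟨fun h => r.trans (r.symm hbc) h, fun h => r.trans hbc h⟩
    simp only [this]
  simp only [ite_mul, one_mul, zero_mul] at this
  rw [Finset.sum_filter, Finset.sum_filter]
  convert this

theorem mem_kRel_ker {c : Cospan (Fin m) (Fin n)} {p : (Fin m → k × k) × (Fin n → k × k)} :
    p ∈ kRel k c.ker ↔ (∃ ψ : c.N → k, ∀ a, pot p a = ψ (c.legs a)) ∧
      ∀ q : c.N → k, ∑ x, q (c.inp x) * (p.1 x).2 = ∑ y, q (c.out y) * (p.2 y).2 := by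
  rw [mem_kRel_iff]
  have key : ∀ q : Fin m ⊕ Fin n → k, (∀ a b, c.ker a b → q a = q b) →
      ∃ ψ : c.N → k, ∀ a, q a = ψ (c.legs a) := fun q hq =>
    ⟨Function.extend c.legs q 0, fun a =>
      ((show Function.FactorsThrough q c.legs from fun a b => hq a b).extend_apply 0 a).symm⟩
  constructor
  · rintro ⟨h, h'⟩
    exact ⟨key _ h, fun q => h' (fun a => q (c.legs a)) fun a b hab => congrArg q hab⟩
  · rintro ⟨⟨ψ, h⟩, h'⟩
    refine ⟨fun a b hab => ?_, fun q hq => ?_⟩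
    · rw [h, h]
      exact congrArg ψ hab
    · obtain ⟨ψ', h''⟩ := key q hq
      simp only [h'']
      exact h' ψ'

theorem kRel_isLag (r : Setoid (Fin m ⊕ Fin n)) : IsLag (kRel k r) := by
  classical
  refine (isLag_iff _).2 fun p => ⟨fun hp q hq => ?_, fun h => mem_kRel_iff.2 ⟨?_, ?_⟩⟩
  · have h1 := (mem_kRel_iff.1 hp).2 _ hq.1
    have h2 := (mem_kRel_iff.1 hq).2 _ hp.1
    simp only [stdForm_apply, Finset.sum_sub_distrib]
    exact congrArg₂ _ h1 h2
  · intro a b hab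
    let J : Fin m ⊕ Fin n → k := Pi.single a 1 - Pi.single b 1
    have hJ : ∀ f : Fin m ⊕ Fin n → k, ∑ x, f (Sum.inl x) * J (Sum.inl x) +
        ∑ y, f (Sum.inr y) * J (Sum.inr y) = f a - f b := by
      intro f
      rw [← Fintype.sum_sum_type (fun z => f z * J z)]
      simp [J, mul_sub, Finset.sum_sub_distrib, Pi.single_apply]
    have := h (fun x => (0, J (Sum.inl x)), fun y => (0, -J (Sum.inr y)))
      (mem_kRel_iff.2 ⟨by rintro (_ | _) (_ | _) _ <;> rfl, fun q hq => ?_⟩)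
    · have h2 := hJ (pot p)
      simp only [stdForm_apply, zero_mul, zero_sub, mul_neg, neg_neg,
        Finset.sum_neg_distrib] at this
      refine sub_eq_zero.1 (h2.symm.trans ?_)
      change ∑ x, (p.1 x).1 * J (Sum.inl x) + ∑ y, (p.2 y).1 * J (Sum.inr y) = 0
      rw [← this, add_neg_cancel]
    · have h2 := hJ q
      rw [hq a b hab, sub_self] at h2
      simp only [mul_neg, Finset.sum_neg_distrib]
      exact eq_neg_of_add_eq_zero_left h2
  · intro q hq
    have := h (fun x => (q (Sum.inl x), 0), fun y => (q (Sum.inr y), 0))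
      (mem_kRel_iff.2 ⟨by rintro (_ | _) (_ | _) h <;> exact hq _ _ h, by simp⟩)
    simpa [stdForm_apply] using this

/-- The morphism of props that sends a corelation to its behaviour. -/
def K (k : Type u) [Field k] : PROPHom FinCorel (LagRel k) where
  map r := ⟨kRel k r, kRel_isLag r⟩
  map_id n := by
    refine Subtype.ext (IsLagrangianRel.eq_of_subset (isLag_id n) (kRel_isLag _) ?_).symm
    rintro ⟨u, v⟩ h
    obtain rfl : u = v := h
    exact mem_kRel_ker.2 ⟨⟨fun x => (u x).1, by rintro (x | x) <;> rfl⟩, fun q => rfl⟩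
  map_comp r s := by
    refine Subtype.ext (IsLagrangianRel.eq_of_subset (isLag_comp _ _ (kRel_isLag r)
      (kRel_isLag s)) (kRel_isLag _) ?_).symm
    rintro ⟨u, v⟩ ⟨w, h, h'⟩
    rw [← Cospan.ker_ofSetoid r, mem_kRel_ker] at h
    rw [← Cospan.ker_ofSetoid s, mem_kRel_ker] at h'
    obtain ⟨⟨ψ, h1⟩, h2⟩ := h
    obtain ⟨⟨ψ', h1'⟩, h2'⟩ := h'
    refine mem_kRel_ker.2 ⟨⟨Pushout.desc ψ ψ' fun y => ?_, ?_⟩, fun q => ?_⟩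
    · exact (h1 (Sum.inr y)).symm.trans (h1' (Sum.inl y))
    · rintro (x | y)
      · exact h1 (Sum.inl x)
      · exact h1' (Sum.inr y)
    · refine (h2 fun a => q (Pushout.inl _ _ a)).trans
        (Eq.trans ?_ (h2' fun b => q (Pushout.inr _ _ b)))
      refine Finset.sum_congr rfl fun y _ => ?_
      exact congrArg (fun t => q t * (w y).2) (Pushout.glue _ _ y)
  map_tensor r s := by
    refine Subtype.ext (IsLagrangianRel.eq_of_subset (isLag_tensor _ _ (kRel_isLag r)
      (kRel_isLag s)) (kRel_isLag _) ?_).symm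
    rintro ⟨u, v⟩ ⟨h, h'⟩
    rw [← Cospan.ker_ofSetoid r, mem_kRel_ker] at h
    rw [← Cospan.ker_ofSetoid s, mem_kRel_ker] at h'
    obtain ⟨⟨ψ, h1⟩, h2⟩ := h
    obtain ⟨⟨ψ', h1'⟩, h2'⟩ := h'
    refine mem_kRel_ker.2 ⟨⟨Sum.elim ψ ψ', Cospan.forall_split (fun a => ?_) fun a => ?_⟩,
      fun q => ?_⟩
    · rw [Cospan.legs_tensor_left]
      exact Eq.trans (by cases a <;> rfl) (h1 a)
    · rw [Cospan.legs_tensor_right]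
      exact Eq.trans (by cases a <;> rfl) (h1' a)
    · have := congrArg₂ (· + ·) (h2 fun a => q (Sum.inl a)) (h2' fun a => q (Sum.inr a))
      rw [Fin.sum_univ_add, Fin.sum_univ_add]
      simpa [Cospan.tensor] using this
  map_braid m n := by
    refine Subtype.ext (IsLagrangianRel.eq_of_subset (isLag_braid m n) (kRel_isLag _) ?_).symm
    rintro ⟨u, v⟩ ⟨h, h'⟩
    refine mem_kRel_ker.2 ⟨⟨fun x => (u x).1, ?_⟩, fun q => ?_⟩
    · rintro (x | x)
      · rfl
      · refine Fin.addCases (fun i => ?_) (fun i => ?_) x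
        · change (v (Fin.castAdd m i)).1 = (u (finAddFlip (Fin.castAdd m i))).1
          rw [finAddFlip_apply_castAdd]
          exact congrArg Prod.fst (h' i).symm
        · change (v (Fin.natAdd n i)).1 = (u (finAddFlip (Fin.natAdd n i))).1
          rw [finAddFlip_apply_natAdd]
          exact congrArg Prod.fst (h i).symm
    · have key : ∀ q : Fin (m + n) → k,
          ∑ x, q x * (u x).2 = ∑ y, q (finAddFlip y) * (v y).2 := fun q => by
        rw [Fin.sum_univ_add, Fin.sum_univ_add, add_comm]
        simp only [finAddFlip_apply_castAdd, finAddFlip_apply_natAdd]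
        refine congrArg₂ _ (Finset.sum_congr rfl fun i _ => ?_)
          (Finset.sum_congr rfl fun i _ => ?_)
        · exact congrArg (fun t => q (Fin.natAdd m i) * t) (congrArg Prod.snd (h' i))
        · exact congrArg (fun t => q (Fin.castAdd n i) * t) (congrArg Prod.snd (h i))
      exact key q

/-- The behaviour of the corelation with a single class, for instance of the generators
`m : 2 → 1`, `i : 0 → 1`, `d : 1 → 2`, `e : 1 → 0`. -/
theorem mem_kRel_top {p : (Fin m → k × k) × (Fin n → k × k)} :
    p ∈ kRel k ⊤ ↔ (∀ a b, pot p a = pot p b) ∧ (IsEmpty (Fin m ⊕ Fin n) ∨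
      ∑ x, (p.1 x).2 = ∑ y, (p.2 y).2) := by
  classical
  have h : ∀ a b, (⊤ : Setoid (Fin m ⊕ Fin n)) a b := fun _ _ => trivial
  rcases isEmpty_or_nonempty (Fin m ⊕ Fin n) with h' | h'
  · have := isEmpty_sum.1 h'
    simp [kRel, h, this]
  · have : ¬ IsEmpty (Fin m ⊕ Fin n) := not_isEmpty_iff.2 h'
    simp only [kRel, h, Set.mem_ofPred_eq, Finset.filter_true, forall_const, this, false_or]

/-- The behaviour of multiplication `m`. -/
theorem mem_kRel_mul {p : (Fin 2 → k × k) × (Fin 1 → k × k)} :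
    p ∈ kRel k ⊤ ↔ ((p.1 0).1 = (p.1 1).1 ∧ (p.1 1).1 = (p.2 0).1) ∧
      (p.1 0).2 + (p.1 1).2 = (p.2 0).2 := by
  rw [mem_kRel_top]
  simp [Sum.forall, pot, Fin.forall_fin_two, Fin.sum_univ_two]
  grind

/-- The behaviour of comultiplication `d`. -/
theorem mem_kRel_comul {p : (Fin 1 → k × k) × (Fin 2 → k × k)} :
    p ∈ kRel k ⊤ ↔ ((p.1 0).1 = (p.2 0).1 ∧ (p.2 0).1 = (p.2 1).1) ∧
      (p.1 0).2 = (p.2 0).2 + (p.2 1).2 := by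
  rw [mem_kRel_top]
  simp [Sum.forall, pot, Fin.forall_fin_two, Fin.sum_univ_two]
  grind

/-- The behaviour of the unit `i`. -/
theorem mem_kRel_unit {p : (Fin 0 → k × k) × (Fin 1 → k × k)} :
    p ∈ kRel k ⊤ ↔ (p.2 0).2 = 0 := by
  rw [mem_kRel_top]
  simp [Sum.forall, pot, eq_comm]

/-- The behaviour of the counit `e`. -/
theorem mem_kRel_counit {p : (Fin 1 → k × k) × (Fin 0 → k × k)} :
    p ∈ kRel k ⊤ ↔ (p.1 0).2 = 0 := by
  rw [mem_kRel_top]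
  simp [Sum.forall, pot]

end K

end Circuits

/-!
The behaviour of a circuit is the set of boundary potentials and currents that extend to potentials
at all nodes and to states of all edges, subject to the law of each edge and to Kirchhoff's current
law. Composing circuits glues nodes together. Current conservation at a glued node only constrains
a total, and one has to recover from it the individual currents in the wires along which the two
circuits are joined: regard currents at the nodes as functionals on potentials; functionals on the
two sides that agree on all potentials on the pushout annihilate a kernel, hence over a field they
factor through the potentials on the wires, and the factor is the family of wire currents. Thus the
behaviour is functorial, even for arbitrary relations as edge laws.

Conversely, every edge of a circuit can be cut out and reattached by bending its two ends around, so
cospans and single edges generate all circuits under composition and tensor product. This gives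
uniqueness. It also shows that the behaviour lies in any prop of relations that contains the
Lagrangian linear relations and the edge laws, for example in that of Lagrangian affine relations.
-/

namespace Circuits

section Charge

variable {k : Type u} [CommSemiring k] {Y Z N N' : Type}

/-- The currents `J y` injected at the nodes `f y`, as a functional on the potentials at the nodes.
Two families of currents have the same total at every node iff they define the same functional, so
Kirchhoff's current law becomes an equation in the dual space. -/
noncomputable def charge [Finite Y] (f : Y → N) (J : Y → k) : Module.Dual k (N → k) :=
  letI := Fintype.ofFinite Y
  Fintype.linearCombination k J ∘ₗ LinearMap.funLeft k k f

/-- The pushforward of functionals along a map of nodes `h`. -/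
noncomputable def pushCharge (h : N → N') :
    Module.Dual k (N → k) →ₗ[k] Module.Dual k (N' → k) :=
  (LinearMap.funLeft k k h).dualMap

theorem charge_apply [Fintype Y] (f : Y → N) (J : Y → k) (q : N → k) :
    charge f J q = ∑ y, q (f y) * J y :=
  Finset.sum_congr (by ext; simp) fun _ _ => rfl

theorem charge_of_isEmpty [Finite Y] [IsEmpty Y] (f : Y → N) (J : Y → k) : charge f J = 0 := by
  have := Fintype.ofFinite Y
  ext q
  simp [charge_apply]

theorem charge_unique [Unique Y] (f : Y → N) (J : Y → k) (q : N → k) :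
    charge f J q = q (f default) * J default := by
  simp [charge_apply]

theorem charge_comp_equiv [Finite Y] [Finite Z] (g : Z ≃ Y) (f : Y → N) (J : Y → k) :
    charge (f ∘ g) (J ∘ g) = charge f J := by
  have := Fintype.ofFinite Y
  have := Fintype.ofFinite Z
  refine LinearMap.ext fun q => ?_
  rw [charge_apply, charge_apply]
  exact g.sum_comp fun y => q (f y) * J y

theorem charge_sumElim [Finite Y] [Finite Z] (f : Y → N) (g : Z → N) (J : Y ⊕ Z → k) :
    charge (Sum.elim f g) J = charge f (J ∘ Sum.inl) + charge g (J ∘ Sum.inr) := by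
  have := Fintype.ofFinite Y
  have := Fintype.ofFinite Z
  refine LinearMap.ext fun q => ?_
  simp [charge_apply]

theorem charge_addCases {m n : ℕ} (f : Fin m → N) (g : Fin n → N) (J : Fin (m + n) → k) :
    charge (Fin.addCases f g) J =
      charge f (J ∘ Fin.castAdd n) + charge g (J ∘ Fin.natAdd m) := by
  refine LinearMap.ext fun q => ?_
  simp [charge_apply, Fin.sum_univ_add]

theorem exists_charge_id_eq [Finite Y] (F : Module.Dual k (Y → k)) :
    ∃ J : Y → k, charge id J = F := by
  classical
  have := Fintype.ofFinite Y
  refine ⟨fun y => F (Pi.single y 1), (Pi.basisFun k Y).ext fun y => ?_⟩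
  simp [charge_apply, Pi.single_apply]

theorem pushCharge_charge [Finite Y] (h : N → N') (f : Y → N) (J : Y → k) :
    pushCharge h (charge f J) = charge (h ∘ f) J :=
  rfl

theorem pushCharge_injective {h : N → N'} (hh : Function.Injective h) :
    Function.Injective (pushCharge (k := k) h) :=
  LinearMap.dualMap_injective_of_surjective (LinearMap.funLeft_surjective_of_injective _ _ _ hh)

theorem pushCharge_inl_add_pushCharge_inr_inj {F F' : Module.Dual k (N → k)}
    {G G' : Module.Dual k (N' → k)} :
    pushCharge (Sum.inl : N → N ⊕ N') F + pushCharge Sum.inr G =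
      pushCharge Sum.inl F' + pushCharge Sum.inr G' ↔ F = F' ∧ G = G' := by
  refine ⟨fun h => ⟨LinearMap.ext fun q => ?_, LinearMap.ext fun q => ?_⟩, ?_⟩
  · simpa [pushCharge, LinearMap.funLeft, Function.comp_def, ← Pi.zero_def] using
      LinearMap.congr_fun h (Sum.elim q 0)
  · simpa [pushCharge, LinearMap.funLeft, Function.comp_def, ← Pi.zero_def] using
      LinearMap.congr_fun h (Sum.elim 0 q)
  · rintro ⟨rfl, rfl⟩
    rfl

end Charge

theorem pushCharge_inl_eq_pushCharge_inr_iff {k : Type u} [Field k] {A B Y : Type} [Finite Y]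
    (f : Y → A) (g : Y → B) (F : Module.Dual k (A → k)) (G : Module.Dual k (B → k)) :
    pushCharge (Pushout.inl f g) F = pushCharge (Pushout.inr f g) G ↔
      ∃ J : Y → k, F = charge f J ∧ G = charge g J := by
  constructor
  · intro h
    -- Potentials on the pushout form the kernel of `T`, and over a field the functionals that
    -- vanish on a kernel are those that factor through the map.
    let T : (A → k) × (B → k) →ₗ[k] (Y → k) :=
      (LinearMap.funLeft k k f).coprod (-LinearMap.funLeft k k g)
    have annihilates : F.coprod (-G) ∈ T.ker.dualAnnihilator := by
      rw [Submodule.mem_dualAnnihilator]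
      rintro ⟨p, q⟩ hpq
      have glued (y : Y) : p (f y) = q (g y) := by
        simpa [T, LinearMap.funLeft_apply, add_neg_eq_zero] using
          congrFun (LinearMap.mem_ker.1 hpq) y
      have agree : F p = G q := LinearMap.congr_fun h (Pushout.desc p q glued)
      simp [agree]
    rw [← LinearMap.range_dualMap_eq_dualAnnihilator_ker] at annihilates
    obtain ⟨D, hD⟩ := annihilates
    obtain ⟨J, rfl⟩ := exists_charge_id_eq D
    have hF := congrArg (· ∘ₗ LinearMap.inl k (A → k) (B → k)) hD
    have hG := congrArg (· ∘ₗ LinearMap.inr k (A → k) (B → k)) hD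
    simp only [T, LinearMap.dualMap_apply', LinearMap.comp_assoc, LinearMap.coprod_inl,
      LinearMap.coprod_inr, LinearMap.comp_neg, neg_inj] at hF hG
    exact ⟨J, hF.symm, hG.symm⟩
  · rintro ⟨J, rfl, rfl⟩
    rw [pushCharge_charge, pushCharge_charge]
    exact congrArg (charge · J) (funext (Pushout.glue f g))

theorem pushCharge_inl_eq_pushCharge_inr_add_iff {k : Type u} [Field k] {A B Y : Type} [Finite Y]
    (f : Y → A) (g : Y → B) (F F' : Module.Dual k (A → k)) (G G' : Module.Dual k (B → k)) :
    pushCharge (Pushout.inl f g) F = pushCharge (Pushout.inr f g) G +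
        (pushCharge (Pushout.inl f g) F' + pushCharge (Pushout.inr f g) G') ↔
      ∃ J : Y → k, F = charge f J + F' ∧ charge g J = G + G' := by
  simp only [← sub_eq_iff_eq_add, eq_comm (a := charge g _)]
  rw [← pushCharge_inl_eq_pushCharge_inr_iff, map_sub, map_add, ← sub_sub, sub_eq_iff_eq_add]

/-- The potentials and currents at the two ends of an edge; the law of an edge is a set of these. -/
abbrev EdgeState (k : Type u) := (Fin 1 → k × k) × (Fin 1 → k × k)

section Flow

variable {k : Type u} [CommRing k] {E E' N N' : Type} [Finite E] [Finite E']

/-- The net currents that leave the nodes through the edges: an edge `e` in state `w e` draws the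
current of its first terminal at its source `s e`, and returns that of its second at its target
`t e`. -/
noncomputable def flow (s t : E → N) (w : E → EdgeState k) : Module.Dual k (N → k) :=
  charge s (fun e => ((w e).1 0).2) - charge t (fun e => ((w e).2 0).2)

theorem flow_of_isEmpty [IsEmpty E] (s t : E → N) (w : E → EdgeState k) : flow s t w = 0 := by
  simp [flow, charge_of_isEmpty]

theorem flow_comp_equiv (g : E' ≃ E) (s t : E → N) (w : E → EdgeState k) :
    flow (s ∘ g) (t ∘ g) (w ∘ g) = flow s t w :=
  congrArg₂ (· - ·) (charge_comp_equiv g s fun e => ((w e).1 0).2)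
    (charge_comp_equiv g t fun e => ((w e).2 0).2)

theorem pushCharge_flow (h : N → N') (s t : E → N) (w : E → EdgeState k) :
    pushCharge h (flow s t w) = flow (h ∘ s) (h ∘ t) w :=
  rfl

theorem flow_sumElim (s t : E → N) (s' t' : E' → N) (w : E ⊕ E' → EdgeState k) :
    flow (Sum.elim s s') (Sum.elim t t') w =
      flow s t (w ∘ Sum.inl) + flow s' t' (w ∘ Sum.inr) := by
  simp only [flow, charge_sumElim]
  exact add_sub_add_comm _ _ _ _

end Flow

section Behaviour

variable {k : Type u} {L : Type v} {X Y : Type} [Finite X] [Finite Y]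

/-- A state of the circuit `c` whose edges obey the laws `α`: potentials `ψ` at the nodes, and
potentials and currents `w` at the ends of the edges and `p` at the inputs and outputs. Potentials
agree where terminals meet, and at every node the currents that enter through the inputs balance
those that leave through the outputs and the edges. -/
structure IsState [CommRing k] (α : L → Set (EdgeState k)) (c : Circuit L X Y) (ψ : c.N → k)
    (w : c.E → EdgeState k) (p : (X → k × k) × (Y → k × k)) : Prop where
  inp : ∀ x, (p.1 x).1 = ψ (c.inp x)
  out : ∀ y, (p.2 y).1 = ψ (c.out y)
  law : ∀ e, w e ∈ α (c.lab e)
  src : ∀ e, ((w e).1 0).1 = ψ (c.src e)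
  tgt : ∀ e, ((w e).2 0).1 = ψ (c.tgt e)
  conserved : charge c.inp (fun x => (p.1 x).2) =
    charge c.out (fun y => (p.2 y).2) + flow c.src c.tgt w

/-- The behaviour of a circuit: the potentials and currents at its inputs and outputs that extend to
a state. -/
def behaviour [CommRing k] (α : L → Set (EdgeState k)) (c : Circuit L X Y) :
    Set ((X → k × k) × (Y → k × k)) :=
  {p | ∃ ψ w, IsState α c ψ w p}

section CommRing

variable [CommRing k] (α : L → Set (EdgeState k))

variable {α} in
theorem IsState.of_iso {c d : Circuit L X Y} (f : c.N ≃ d.N) (g : c.E ≃ d.E)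
    (hinp : f ∘ c.inp = d.inp) (hout : f ∘ c.out = d.out) (hsrc : f ∘ c.src = d.src ∘ g)
    (htgt : f ∘ c.tgt = d.tgt ∘ g) (hlab : c.lab = d.lab ∘ g) {ψ : d.N → k}
    {w : d.E → EdgeState k} {p : (X → k × k) × (Y → k × k)} (h : IsState α d ψ w p) :
    IsState α c (ψ ∘ f) (w ∘ g) p where
  inp x := by rw [h.inp, ← hinp]; rfl
  out y := by rw [h.out, ← hout]; rfl
  law e := by rw [hlab]; exact h.law (g e)
  src e := (h.src (g e)).trans (congrArg ψ (congrFun hsrc e).symm)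
  tgt e := (h.tgt (g e)).trans (congrArg ψ (congrFun htgt e).symm)
  conserved := pushCharge_injective f.injective <| by
    rw [map_add, pushCharge_charge, pushCharge_charge, pushCharge_flow, hinp, hout, hsrc, htgt,
      flow_comp_equiv]
    exact h.conserved

theorem behaviour_congr {c d : Circuit L X Y} (h : Circuit.Iso c d) :
    behaviour α c = behaviour α d := by
  have subset {c d : Circuit L X Y} : Circuit.Iso c d → behaviour α d ⊆ behaviour α c := by
    rintro ⟨f, g, hinp, hout, hsrc, htgt, hlab⟩ p ⟨ψ, w, hp⟩
    exact ⟨ψ ∘ f, w ∘ g, hp.of_iso f g (funext hinp) (funext hout) (funext hsrc) (funext htgt)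
      (funext hlab)⟩
  exact (subset h.symm).antisymm (subset h)

theorem isState_tensor_iff {m n m' n' : ℕ} (c : Circuit L (Fin m) (Fin n))
    (d : Circuit L (Fin m') (Fin n')) (ψ : c.N ⊕ d.N → k)
    (w : c.E ⊕ d.E → EdgeState k) (u : Fin (m + m') → k × k)
    (v : Fin (n + n') → k × k) :
    IsState α (c.tensor d) ψ w (u, v) ↔
      IsState α c (ψ ∘ Sum.inl) (w ∘ Sum.inl) (u ∘ Fin.castAdd m', v ∘ Fin.castAdd n') ∧
        IsState α d (ψ ∘ Sum.inr) (w ∘ Sum.inr) (u ∘ Fin.natAdd m, v ∘ Fin.natAdd n) := by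
  have conserved_iff :
      charge (c.tensor d).inp (fun x => (u x).2) =
          charge (c.tensor d).out (fun y => (v y).2) + flow (c.tensor d).src (c.tensor d).tgt w ↔
        charge c.inp (fun x => (u (Fin.castAdd m' x)).2) =
            charge c.out (fun y => (v (Fin.castAdd n' y)).2) + flow c.src c.tgt (w ∘ Sum.inl) ∧
          charge d.inp (fun x => (u (Fin.natAdd m x)).2) =
            charge d.out (fun y => (v (Fin.natAdd n y)).2) + flow d.src d.tgt (w ∘ Sum.inr) := by
    rw [← pushCharge_inl_add_pushCharge_inr_inj, map_add, map_add, add_add_add_comm]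
    exact Eq.congr (charge_addCases (Sum.inl ∘ c.inp) (Sum.inr ∘ d.inp) _)
      (congrArg₂ (· + ·) (charge_addCases (Sum.inl ∘ c.out) (Sum.inr ∘ d.out) _)
        (flow_sumElim (Sum.inl ∘ c.src) (Sum.inl ∘ c.tgt) (Sum.inr ∘ d.src) (Sum.inr ∘ d.tgt) w))
  constructor
  · rintro ⟨inp, out, law, src, tgt, conserved⟩
    obtain ⟨conserved_c, conserved_d⟩ := conserved_iff.1 conserved
    refine ⟨⟨fun x => ?_, fun y => ?_, fun e => law (.inl e), fun e => src (.inl e),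
        fun e => tgt (.inl e), conserved_c⟩,
      ⟨fun x => ?_, fun y => ?_, fun e => law (.inr e), fun e => src (.inr e),
        fun e => tgt (.inr e), conserved_d⟩⟩
    · exact (inp _).trans (congrArg ψ (c.tensor_inp_left d x))
    · exact (out _).trans (congrArg ψ (c.tensor_out_left d y))
    · exact (inp _).trans (congrArg ψ (c.tensor_inp_right d x))
    · exact (out _).trans (congrArg ψ (c.tensor_out_right d y))
  · rintro ⟨hc, hd⟩
    refine ⟨Fin.addCases (fun x => ?_) (fun x => ?_), Fin.addCases (fun y => ?_) (fun y => ?_),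
      Sum.rec hc.law hd.law, Sum.rec hc.src hd.src, Sum.rec hc.tgt hd.tgt,
      conserved_iff.2 ⟨hc.conserved, hd.conserved⟩⟩
    · exact (hc.inp x).trans (congrArg ψ (c.tensor_inp_left d x).symm)
    · exact (hd.inp x).trans (congrArg ψ (c.tensor_inp_right d x).symm)
    · exact (hc.out y).trans (congrArg ψ (c.tensor_out_left d y).symm)
    · exact (hd.out y).trans (congrArg ψ (c.tensor_out_right d y).symm)

theorem behaviour_tensor {m n m' n' : ℕ} (c : Circuit L (Fin m) (Fin n))
    (d : Circuit L (Fin m') (Fin n')) :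
    behaviour α (c.tensor d) = (RelProp (k × k)).tensor (behaviour α c) (behaviour α d) := by
  ext ⟨u, v⟩
  constructor
  · rintro ⟨ψ, w, h⟩
    obtain ⟨hc, hd⟩ := (isState_tensor_iff α c d ψ w u v).1 h
    exact ⟨⟨_, _, hc⟩, ⟨_, _, hd⟩⟩
  · rintro ⟨⟨ψ, w, hc⟩, ⟨ψ', w', hd⟩⟩
    exact ⟨Sum.elim ψ ψ', Sum.elim w w', (isState_tensor_iff α c d _ _ u v).2 ⟨hc, hd⟩⟩

theorem behaviour_edge (ℓ : L) : behaviour α (Circuit.edge ℓ) = α ℓ := by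
  have conserved_iff (u v : Fin 1 → k × k) (w : Unit → EdgeState k) :
      charge (fun _ : Fin 1 => false) (fun x => (u x).2) =
          charge (fun _ : Fin 1 => true) (fun y => (v y).2) +
            flow (fun _ => false) (fun _ => true) w ↔
        (u 0).2 = ((w ()).1 0).2 ∧ (v 0).2 = ((w ()).2 0).2 := by
    simp only [LinearMap.ext_iff, flow, LinearMap.add_apply, LinearMap.sub_apply, charge_unique,
      Fin.default_eq_zero, PUnit.default_eq_unit]
    refine ⟨fun h => ⟨?_, ?_⟩, fun ⟨hu, hv⟩ q => by rw [hu, hv]; ring⟩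
    · simpa using h fun b => bif b then 0 else 1
    · simpa [add_neg_eq_zero] using (h fun b => bif b then 1 else 0).symm
  ext ⟨u, v⟩
  constructor
  · rintro ⟨ψ, w, h⟩
    obtain ⟨hu, hv⟩ := (conserved_iff u v w).1 h.conserved
    have boundary_eq : (u, v) = w () := by
      refine Prod.ext (funext fun i => ?_) (funext fun i => ?_) <;> rw [Subsingleton.elim i 0]
      · exact Prod.ext ((h.inp 0).trans (h.src ()).symm) hu
      · exact Prod.ext ((h.out 0).trans (h.tgt ()).symm) hv
    exact boundary_eq ▸ h.law ()
  · intro h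
    refine ⟨fun b => bif b then (v 0).1 else (u 0).1, fun _ => (u, v), fun x => ?_, fun y => ?_,
      fun _ => h, fun _ => rfl, fun _ => rfl, (conserved_iff u v _).2 ⟨rfl, rfl⟩⟩
    · rw [Subsingleton.elim x 0]; rfl
    · rw [Subsingleton.elim y 0]; rfl

end CommRing

section Field

variable [Field k] (α : L → Set (EdgeState k))

theorem isState_comp_iff {Z : Type} [Finite Z] (c : Circuit L X Y) (d : Circuit L Y Z)
    (ψ : Pushout c.out d.inp → k) (w : c.E ⊕ d.E → EdgeState k)
    (u : X → k × k) (v : Z → k × k) :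
    IsState α (c.comp d) ψ w (u, v) ↔
      ∃ x : Y → k × k,
        IsState α c (ψ ∘ Pushout.inl c.out d.inp) (w ∘ Sum.inl) (u, x) ∧
          IsState α d (ψ ∘ Pushout.inr c.out d.inp) (w ∘ Sum.inr) (x, v) := by
  have conserved_iff :
      charge (c.comp d).inp (fun x => (u x).2) =
          charge (c.comp d).out (fun z => (v z).2) + flow (c.comp d).src (c.comp d).tgt w ↔
        ∃ J : Y → k,
          charge c.inp (fun x => (u x).2) = charge c.out J + flow c.src c.tgt (w ∘ Sum.inl) ∧
            charge d.inp J =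
              charge d.out (fun z => (v z).2) + flow d.src d.tgt (w ∘ Sum.inr) := by
    rw [← pushCharge_inl_eq_pushCharge_inr_add_iff]
    exact Eq.congr_right (congrArg (charge (c.comp d).out _ + ·)
      (flow_sumElim (Pushout.inl c.out d.inp ∘ c.src) (Pushout.inl c.out d.inp ∘ c.tgt)
        (Pushout.inr c.out d.inp ∘ d.src) (Pushout.inr c.out d.inp ∘ d.tgt) w))
  constructor
  · rintro ⟨inp, out, law, src, tgt, conserved⟩
    obtain ⟨J, conserved_c, conserved_d⟩ := conserved_iff.1 conserved
    exact ⟨fun y => (ψ (Pushout.inl c.out d.inp (c.out y)), J y),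
      ⟨inp, fun _ => rfl, fun e => law (.inl e), fun e => src (.inl e), fun e => tgt (.inl e),
        conserved_c⟩,
      ⟨fun y => congrArg ψ (Pushout.glue c.out d.inp y), out, fun e => law (.inr e),
        fun e => src (.inr e), fun e => tgt (.inr e), conserved_d⟩⟩
  · rintro ⟨x, hc, hd⟩
    exact ⟨hc.inp, hd.out, Sum.rec hc.law hd.law, Sum.rec hc.src hd.src, Sum.rec hc.tgt hd.tgt,
      conserved_iff.2 ⟨fun y => (x y).2, hc.conserved, hd.conserved⟩⟩

theorem behaviour_comp {l m n : ℕ} (c : Circuit L (Fin l) (Fin m))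
    (d : Circuit L (Fin m) (Fin n)) :
    behaviour α (c.comp d) = (RelProp (k × k)).comp (behaviour α c) (behaviour α d) := by
  ext ⟨u, v⟩
  constructor
  · rintro ⟨ψ, w, h⟩
    obtain ⟨x, hc, hd⟩ := (isState_comp_iff α c d ψ w u v).1 h
    exact ⟨x, ⟨_, _, hc⟩, ⟨_, _, hd⟩⟩
  · rintro ⟨x, ⟨ψ, w, hc⟩, ⟨ψ', w', hd⟩⟩
    exact ⟨Pushout.desc ψ ψ' fun y => (hc.out y).symm.trans (hd.inp y), Sum.elim w w',
      (isState_comp_iff α c d _ _ u v).2 ⟨x, hc, hd⟩⟩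

theorem behaviour_toCircuit {m n : ℕ} (c : Cospan (Fin m) (Fin n)) :
    behaviour α (c.toCircuit L) = kRel k c.ker := by
  ext p
  rw [mem_kRel_ker]
  have conserved_iff (w : (c.toCircuit L).E → EdgeState k) :
      charge (c.toCircuit L).inp (fun x => (p.1 x).2) =
          charge (c.toCircuit L).out (fun y => (p.2 y).2) +
            flow (c.toCircuit L).src (c.toCircuit L).tgt w ↔
        ∀ q : c.N → k, ∑ x, q (c.inp x) * (p.1 x).2 = ∑ y, q (c.out y) * (p.2 y).2 := by
    rw [flow_of_isEmpty, add_zero, LinearMap.ext_iff]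
    simp only [charge_apply]
    rfl
  constructor
  · rintro ⟨ψ, w, h⟩
    exact ⟨⟨ψ, Sum.rec h.inp h.out⟩, (conserved_iff w).1 h.conserved⟩
  · rintro ⟨⟨ψ, hψ⟩, balanced⟩
    exact ⟨ψ, isEmptyElim, fun x => hψ (.inl x), fun y => hψ (.inr y), isEmptyElim, isEmptyElim,
      isEmptyElim, (conserved_iff _).2 balanced⟩

end Field

end Behaviour

section BlackBox

variable {k : Type u} [Field k] {L : Type v} (α : L → (RelProp (k × k)).Hom 1 1)

/-- The behaviour of circuits as a morphism of props. The laws `α` of the edges are arbitrary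
relations, so the behaviour need not be Lagrangian. -/
def blackBox : PROPHom (Circ L) (RelProp (k × k)) where
  map := Quotient.lift (behaviour α) fun _ _ => behaviour_congr α
  map_id n := (behaviour_toCircuit α (Cospan.ofFun id)).trans
    (congrArg Subtype.val (((K k).comp H).map_id n))
  map_comp := by
    rintro _ _ _ ⟨c⟩ ⟨d⟩
    exact behaviour_comp α c d
  map_tensor := by
    rintro _ _ _ _ ⟨c⟩ ⟨d⟩
    exact behaviour_tensor α c d
  map_braid m n := (behaviour_toCircuit α (Cospan.ofFun _)).trans
    (congrArg Subtype.val (((K k).comp H).map_braid m n))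

theorem blackBox_toCirc {m n : ℕ} (c : FinCospan.Hom m n) :
    (blackBox α).map ((FinCospan.toCirc L).map c) = (((K k).comp H).map c).1 := by
  obtain ⟨c⟩ := c
  exact behaviour_toCircuit α c

theorem blackBox_edge (ℓ : L) : (blackBox α).map (Circ.edge ℓ) = α ℓ :=
  behaviour_edge α ℓ

end BlackBox

section Generation

variable {L : Type u}

theorem Circuit.comp_iso_of_surjective {X Y Z : Type} (c : Circuit L X Y) (d : Circuit L Y Z)
    (hc : Function.Surjective c.out) (h : c.N → d.N) (glued : ∀ y, h (c.out y) = d.inp y) :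
    Iso (c.comp d)
      { N := d.N
        inp := h ∘ c.inp
        out := d.out
        E := c.E ⊕ d.E
        src := Sum.elim (h ∘ c.src) d.src
        tgt := Sum.elim (h ∘ c.tgt) d.tgt
        lab := Sum.elim c.lab d.lab } := by
  refine ⟨⟨Pushout.desc h id glued, Pushout.inr c.out d.inp, Pushout.ind (fun a => ?_) ?_,
    fun _ => rfl⟩, Equiv.refl _, fun _ => rfl, fun _ => rfl, Sum.rec (fun _ => rfl) fun _ => rfl,
    Sum.rec (fun _ => rfl) fun _ => rfl, fun _ => rfl⟩
  · obtain ⟨y, rfl⟩ := hc a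
    exact (congrArg (Pushout.inr c.out d.inp) (glued y)).trans (Pushout.glue c.out d.inp y).symm
  · exact fun _ => rfl

/-- The one-node cospan with two outputs, which bends a wire around. -/
def cup : Cospan (Fin 0) (Fin 2) where
  N := Unit
  inp _ := ()
  out _ := ()

/-- The circuit with a single edge, both ends of which are outputs. -/
def Circuit.bentEdge (ℓ : L) : Circuit L (Fin 0) (Fin 2) where
  N := Bool
  inp := Fin.elim0
  out := ![false, true]
  E := Unit
  src _ := false
  tgt _ := true
  lab _ := ℓ

/-- The circuit `c` with the edge `e₀` removed and its ends turned into two additional inputs. -/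
def Circuit.cutEdge {m : ℕ} {Y : Type} (c : Circuit L (Fin m) Y) (e₀ : c.E) :
    Circuit L (Fin (m + 2)) Y where
  N := c.N
  inp := Fin.addCases c.inp ![c.src e₀, c.tgt e₀]
  out := c.out
  E := {e // e ≠ e₀}
  src e := c.src e
  tgt e := c.tgt e
  lab e := c.lab e

theorem Circuit.cup_comp_iso_bentEdge (ℓ : L) :
    Iso ((cup.toCircuit L).comp ((ofFun L (id : Fin 1 → Fin 1)).tensor (edge ℓ)))
      (bentEdge ℓ) := by
  let t := (ofFun L (id : Fin 1 → Fin 1)).tensor (edge ℓ)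
  let nodes : Pushout cup.out t.inp → Bool :=
    Pushout.desc (fun _ => false) (Sum.elim (fun _ => false) id)
      (Fin.forall_fin_two.2 ⟨rfl, rfl⟩)
  refine ⟨⟨nodes, fun b => Pushout.inr cup.out t.inp (Sum.inr b), Pushout.ind (fun _ => ?_) ?_,
    fun _ => rfl⟩, ⟨fun _ => (), fun _ => Sum.inr (Sum.inr ()), ?_, fun _ => rfl⟩,
    fun x => x.elim0, Fin.forall_fin_two.2 ⟨rfl, rfl⟩, ?_, ?_, ?_⟩
  · exact (Pushout.glue cup.out t.inp 1).symm
  · rintro (i | b)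
    · obtain rfl : i = (0 : Fin 1) := Subsingleton.elim (α := Fin 1) i 0
      exact (Pushout.glue cup.out t.inp 1).symm.trans (Pushout.glue cup.out t.inp 0)
    · rfl
  all_goals
    rintro (e | e | e)
    · exact e.elim
    · exact e.elim
    · rfl

theorem Circuit.bentEdge_comp_cutEdge_iso {m : ℕ} {Y : Type} (c : Circuit L (Fin m) Y)
    (e₀ : c.E) :
    Iso (((ofFun L (id : Fin m → Fin m)).tensor (bentEdge (c.lab e₀))).comp (c.cutEdge e₀)) c := by
  classical
  let nodes : Fin m ⊕ Bool → c.N :=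
    Sum.elim c.inp fun b => bif b then c.tgt e₀ else c.src e₀
  let edges : (Empty ⊕ Unit) ⊕ {e // e ≠ e₀} ≃ c.E :=
    ((Equiv.emptySum Empty Unit).sumCongr (Equiv.refl _)).trans <|
      (Equiv.sumComm _ _).trans <|
        (Equiv.optionEquivSumPUnit _).symm.trans (Equiv.optionSubtypeNe e₀)
  refine (comp_iso_of_surjective _ _ ?_ nodes ?_).trans
    ⟨Equiv.refl _, edges, ?_, fun _ => rfl, ?_, ?_, ?_⟩
  · rintro (i | _ | _)
    · exact ⟨Fin.castAdd 2 i, tensor_out_left _ _ i⟩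
    · exact ⟨Fin.natAdd m 0, tensor_out_right _ _ 0⟩
    · exact ⟨Fin.natAdd m 1, tensor_out_right _ _ 1⟩
  · refine Fin.addCases (fun i => ?_) (fun i => ?_)
    · exact (congrArg nodes (tensor_out_left _ _ i)).trans
        (Fin.addCases_left (motive := fun _ => c.N) i).symm
    · refine (congrArg nodes (tensor_out_right _ _ i)).trans
        (Eq.trans ?_ (Fin.addCases_right (motive := fun _ => c.N) i).symm)
      fin_cases i <;> rfl
  · exact fun x => congrArg nodes (tensor_inp_left (ofFun L id) (bentEdge (c.lab e₀)) x)
  all_goals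
    rintro ((e | e) | e)
    · exact e.elim
    · rfl
    · rfl

theorem Circuit.iso_toCircuit_of_isEmpty {X Y : Type} (c : Circuit L X Y) [IsEmpty c.E] :
    Iso c (c.toCospan.toCircuit L) :=
  ⟨Equiv.refl _, Equiv.equivOfIsEmpty c.E Empty, fun _ => rfl, fun _ => rfl, isEmptyElim,
    isEmptyElim, isEmptyElim⟩

theorem Circ.induction {p : ∀ {m n : ℕ}, (Circ L).Hom m n → Prop}
    (cospan : ∀ {m n : ℕ} (c : FinCospan.Hom m n), p ((FinCospan.toCirc L).map c))
    (edge : ∀ ℓ : L, p (Circ.edge ℓ))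
    (comp : ∀ {l m n : ℕ} (f : (Circ L).Hom l m) (g : (Circ L).Hom m n),
      p f → p g → p ((Circ L).comp f g))
    (tensor : ∀ {m n m' n' : ℕ} (f : (Circ L).Hom m n) (g : (Circ L).Hom m' n'),
      p f → p g → p ((Circ L).tensor f g)) {m n : ℕ} (f : (Circ L).Hom m n) : p f := by
  let mk {m n : ℕ} (c : Circuit L (Fin m) (Fin n)) : (Circ L).Hom m n := Quotient.mk _ c
  have of_iso {m n : ℕ} {c d : Circuit L (Fin m) (Fin n)} (h : Circuit.Iso c d) :
      p (mk c) → p (mk d) :=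
    (congrArg p (Quotient.sound h : mk c = mk d)).mp
  have cospan_circuit {m n : ℕ} (c : Cospan (Fin m) (Fin n)) : p (mk (c.toCircuit L)) :=
    cospan (Quotient.mk _ c)
  have bentEdge (ℓ : L) : p (mk (Circuit.bentEdge ℓ)) :=
    of_iso (Circuit.cup_comp_iso_bentEdge ℓ) <|
      comp _ _ (cospan_circuit cup) (tensor _ _ (cospan_circuit (Cospan.ofFun id)) (edge ℓ))
  have circuit {m n : ℕ} (c : Circuit L (Fin m) (Fin n)) : p (mk c) := by
    induction hN : Nat.card c.E using Nat.strong_induction_on generalizing m with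
    | _ N ih =>
      rcases isEmpty_or_nonempty c.E with hE | ⟨⟨e₀⟩⟩
      · exact of_iso c.iso_toCircuit_of_isEmpty.symm (cospan_circuit c.toCospan)
      · have fewer_edges : Nat.card (c.cutEdge e₀).E < N :=
          hN ▸ Finite.card_subtype_lt (p := (· ≠ e₀)) (x := e₀) (not_not.2 rfl)
        exact of_iso (c.bentEdge_comp_cutEdge_iso e₀) <|
          comp _ _ (tensor _ _ (cospan_circuit (Cospan.ofFun id)) (bentEdge _))
            (ih _ fewer_edges _ rfl)
  obtain ⟨c⟩ := f
  exact circuit c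

theorem Circ.hom_ext {Q : PROP.{w}} {F G : PROPHom (Circ L) Q}
    (hcospan : F.comp (FinCospan.toCirc L) = G.comp (FinCospan.toCirc L))
    (hedge : ∀ ℓ : L, F.map (Circ.edge ℓ) = G.map (Circ.edge ℓ)) : F = G := by
  refine PROPHom.ext (funext fun m => funext fun n => funext fun f => ?_)
  induction f using Circ.induction with
  | cospan c => exact congrArg (fun F : PROPHom FinCospan Q => F.map c) hcospan
  | edge ℓ => exact hedge ℓ
  | comp f g hf hg => rw [F.map_comp, G.map_comp, hf, hg]
  | tensor f g hf hg => rw [F.map_tensor, G.map_tensor, hf, hg]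

end Generation

/-- The lift of a morphism of props `F` through a faithful morphism `ι` whose image contains that of
`F`. -/
noncomputable def PROPHom.lift {P : PROP.{u}} {Q : PROP.{v}} {R : PROP.{w}} (ι : PROPHom Q R)
    (hι : ∀ m n : ℕ, Function.Injective (ι.map (m := m) (n := n))) (F : PROPHom P R)
    (hF : ∀ {m n : ℕ} (f : P.Hom m n), ∃ g, ι.map g = F.map f) : PROPHom P Q where
  map f := (hF f).choose
  map_id n := hι _ _ <| by rw [(hF _).choose_spec, F.map_id, ι.map_id]
  map_comp f g := hι _ _ <| by
    rw [(hF _).choose_spec, F.map_comp, ι.map_comp, (hF f).choose_spec, (hF g).choose_spec]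
  map_tensor f g := hι _ _ <| by
    rw [(hF _).choose_spec, F.map_tensor, ι.map_tensor, (hF f).choose_spec, (hF g).choose_spec]
  map_braid m n := hι _ _ <| by rw [(hF _).choose_spec, F.map_braid, ι.map_braid]

theorem PROPHom.map_lift_map {P : PROP.{u}} {Q : PROP.{v}} {R : PROP.{w}} (ι : PROPHom Q R)
    (hι : ∀ m n : ℕ, Function.Injective (ι.map (m := m) (n := n))) (F : PROPHom P R)
    (hF : ∀ {m n : ℕ} (f : P.Hom m n), ∃ g, ι.map g = F.map f) {m n : ℕ} (f : P.Hom m n) :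
    ι.map ((PROPHom.lift ι hι F hF).map f) = F.map f :=
  (hF f).choose_spec

/-- The inclusion of Lagrangian affine relations in all relations. -/
def AffLagRel.toRelProp (k : Type u) [Field k] : PROPHom (AffLagRel k) (RelProp (k × k)) where
  map R := R.1
  map_id _ := rfl
  map_comp _ _ := rfl
  map_tensor _ _ := rfl
  map_braid _ _ := rfl

theorem blackBox_mem_range {k : Type u} [Field k] {L : Type v} {Q : PROP.{w}}
    (J : PROPHom (LagRel k) Q) (ι : PROPHom Q (RelProp (k × k)))
    (hJ : ∀ {m n : ℕ} (R : (LagRel k).Hom m n), ι.map (J.map R) = R.1) (α : L → Q.Hom 1 1)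
    {m n : ℕ} (f : (Circ L).Hom m n) :
    ∃ g, ι.map g = (blackBox fun ℓ => ι.map (α ℓ)).map f := by
  induction f using Circ.induction with
  | cospan c => exact ⟨J.map (((K k).comp H).map c), (hJ _).trans (blackBox_toCirc _ c).symm⟩
  | edge ℓ => exact ⟨α ℓ, (blackBox_edge (fun ℓ => ι.map (α ℓ)) ℓ).symm⟩
  | comp f g hf hg =>
    obtain ⟨f', hf'⟩ := hf
    obtain ⟨g', hg'⟩ := hg
    exact ⟨Q.comp f' g', by rw [ι.map_comp, PROPHom.map_comp, hf', hg']⟩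
  | tensor f g hf hg =>
    obtain ⟨f', hf'⟩ := hf
    obtain ⟨g', hg'⟩ := hg
    exact ⟨Q.tensor f' g', by rw [ι.map_tensor, PROPHom.map_tensor, hf', hg']⟩

end Circuits

open Circuits in
theorem mainTheorem5_general {k : Type u} [Field k] {L : Type v} {Q : PROP.{w}}
    (J : PROPHom (LagRel k) Q) (ι : PROPHom Q (RelProp (k × k)))
    (hι : ∀ m n : ℕ, Function.Injective (ι.map (m := m) (n := n)))
    (hJ : ∀ {m n : ℕ} (R : (LagRel k).Hom m n), ι.map (J.map R) = R.1) (α : L → Q.Hom 1 1) :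
    ∃! B : PROPHom (Circ L) Q,
      B.comp (FinCospan.toCirc L) = J.comp ((K k).comp H) ∧
      ∀ ℓ : L, B.map (Circ.edge ℓ) = α ℓ := by
  let B := PROPHom.lift ι hι (blackBox fun ℓ => ι.map (α ℓ)) (blackBox_mem_range J ι hJ α)
  have map_B {m n : ℕ} (f : (Circ L).Hom m n) :
      ι.map (B.map f) = (blackBox fun ℓ => ι.map (α ℓ)).map f :=
    PROPHom.map_lift_map ι hι _ _ f
  have B_toCirc : B.comp (FinCospan.toCirc L) = J.comp ((K k).comp H) :=
    PROPHom.ext <| funext fun _ => funext fun _ => funext fun c => hι _ _ <|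
      calc ι.map (B.map ((FinCospan.toCirc L).map c))
        _ = (((K k).comp H).map c).1 := (map_B _).trans (blackBox_toCirc _ c)
        _ = ι.map (J.map (((K k).comp H).map c)) := (hJ _).symm
  have B_edge (ℓ : L) : B.map (Circ.edge ℓ) = α ℓ := hι _ _ ((map_B _).trans (blackBox_edge _ ℓ))
  exact ⟨B, ⟨B_toCirc, B_edge⟩, fun B' ⟨B'_toCirc, B'_edge⟩ =>
    Circ.hom_ext (B'_toCirc.trans B_toCirc.symm) fun ℓ => (B'_edge ℓ).trans (B_edge ℓ).symm⟩

theorem mainTheorem5 {k : Type u} [Field k] {L : Type v}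
    (α : L → (Circuits.AffLagRel k).Hom 1 1) :
    ∃! B : Circuits.PROPHom (Circuits.Circ L) (Circuits.AffLagRel k),
      B.comp (Circuits.FinCospan.toCirc L) =
        (Circuits.LagRel.toAffLagRel k).comp ((Circuits.K k).comp Circuits.H) ∧
      ∀ ℓ : L, B.map (Circuits.Circ.edge ℓ) = α ℓ :=
  mainTheorem5_general (Circuits.LagRel.toAffLagRel k) (Circuits.AffLagRel.toRelProp k)
    (fun _ _ => Subtype.val_injective) (fun _ => rfl) α
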